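/- For $0<\delta\le 1$ let $\widetilde p_\delta(\xi)=\frac{3}{\delta}\big(\xi^2\coth(\delta\xi)-\frac{\xi}{\delta}\big)$ (with $\widetilde p_\delta(0)=0$) be the dispersion relation of the scaled intermediate long wave equation, and let $\widetilde p_0(\xi)=\xi^3$. For $s,b\in\mathbb R$ let $$\|v\|_{X^{s,b}_\delta}=\big\|\langle\xi\rangle^s\langle\tau-\widetilde p_\delta(\xi)\rangle^b\,\widehat v(\tau,\xi)\big\|_{L^2_{\tau,\xi}(\mathbb R^2)},\qquad \langle y\rangle=(1+y^2)^{1/2},$$ where $\widehat v(\tau,\xi)=\int_{\mathbb R^2} v(t,x)e^{-i(t\tau+x\xi)}\,dt\,dx$ is the space-time Fourier transform. Let $\mathbf P_{\delta^{-1}}$ be the sharp Fourier projection onto the spatial frequencies $\{|\xi|\le\delta^{-1}\}$, with $\mathbf P_{\delta^{-1}}=\mathrm{Id}$ when $\delta=0$. Lemma (low $\times$ low $\mapsto$ low). Let $s\ge 0$, $b>\frac12$ and $b'\le\frac58$. Then there is a constant $C=C(s,b,b')$ such that for every $0\le\delta\le1$ and all complex-valued $v_1,v_2,v$ on $\mathbb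 R_t\times\mathbb R_x$ (tempered distributions whose Fourier transforms are functions) with $\mathbf P_{\delta^{-1}}v_1,\mathbf P_{\delta^{-1}}v_2,\mathbf P_{\delta^{-1}}v\in X^{s,b}_\delta$, $$\big\|\mathbf P_{\delta^{-1}}\partial_x\big((\mathbf P_{\delta^{-1}}v_1)(\mathbf P_{\delta^{-1}}v_2)\big)\big\|_{X^{s,b'-1}_\delta}\le C\prod_{j=1}^2\|\mathbf P_{\delta^{-1}}v_j\|_{X^{s,b}_\delta},$$ $$\big\|\mathbf P_{\delta^{-1}}\partial_x\big((\mathbf P_{\delta^{-1}}v)^2\big)\big\|_{X^{s,b'-1}_\delta}\le C\,\|\mathbf P_{\delta^{-1}}v\|_{X^{0,b}_\delta}\|\mathbf P_{\delta^{-1}}v\|_{X^{s,b}_\delta}.$$ (In particular each $\mathbf P_{\delta^{-1}}v_j$ and $\mathbf P_{\delta^{-1}}v$ lies in $L^2(\mathbb R^2)$, so that the products are well defined.) -/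

import Mathlib

open MeasureTheory SchwartzMap FourierTransform LineDeriv
open scoped ENNReal NNReal

noncomputable section

namespace ScaledILW

/-- Space-time `ℝ_t × ℝ_x`, with coordinate `0` the time `t` and coordinate `1` the position `x`.
On the Fourier side, coordinate `0` is `τ` and coordinate `1` is `ξ`. -/
abbrev Spacetime : Type := EuclideanSpace ℝ (Fin 2)

/-- The Japanese bracket `⟨y⟩ = (1 + y²)^{1/2}`. -/
def bracket (y : ℝ) : ℝ := √(1 + y ^ 2)

/-- The dispersion relation of the scaled intermediate long wave equation,
`p_δ(ξ) = (3/δ) (ξ² coth(δξ) - ξ/δ)` for `δ > 0` (with value `0` at `ξ = 0`), and `p_0(ξ) = ξ³`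
(the KdV case). -/
def dispersion (δ ξ : ℝ) : ℝ :=
  if δ = 0 then ξ ^ 3
  else 3 / δ * (ξ ^ 2 * (Real.cosh (δ * ξ) / Real.sinh (δ * ξ)) - ξ / δ)

/-- The tempered distribution `T` is the function `f`, i.e. `T φ = ∫ φ f` for all Schwartz `φ`.
Such an `f` is unique up to almost everywhere equality. -/
def IsGivenBy (T : 𝓢'(Spacetime, ℂ)) (f : Spacetime → ℂ) : Prop :=
  ∀ φ : 𝓢(Spacetime, ℂ), Integrable (fun z => φ z * f z) ∧ T φ = ∫ z, φ z * f z

/-- The space-time Fourier transform of `T` in angular frequencies, formally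
`g (τ, ξ) = ∫ T(t, x) e^{-i (t τ + x ξ)} dt dx`, is the function `g`. Mathlib's `𝓕` has the kernel
`e^{-2π i (t τ + x ξ)}`, whence the dilation by `2π`. -/
def HasFourier (T : 𝓢'(Spacetime, ℂ)) (g : Spacetime → ℂ) : Prop :=
  IsGivenBy (𝓕 T) (fun ω => g ((2 * Real.pi) • ω))

/-- The set of frequencies `(τ, ξ)` with `|ξ| ≤ δ⁻¹`; all frequencies if `δ = 0`. -/
def lowFreq (δ : ℝ) : Set Spacetime := {z | δ = 0 ∨ |z 1| ≤ δ⁻¹}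

/-- `U = P_{δ⁻¹} T`: the sharp (Dirichlet) projection onto the spatial frequencies `|ξ| ≤ δ⁻¹`,
which is the identity for `δ = 0`. It applies to the `T` whose Fourier transform is a function,
and it then determines `U`. -/
def IsLowProj (δ : ℝ) (T U : 𝓢'(Spacetime, ℂ)) : Prop :=
  ∃ g : Spacetime → ℂ, HasFourier T g ∧ HasFourier U ((lowFreq δ).indicator g)

/-- The norm `‖T‖_{X^{s,b}_δ} = ‖⟨ξ⟩^s ⟨τ - p_δ(ξ)⟩^b T^(τ, ξ)‖_{L²_{τ,ξ}}`, with value `∞` if the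
integral diverges or if the Fourier transform of `T` is not a function. (The infimum is over the
functions that represent the Fourier transform, all of which agree almost everywhere.) -/
def XNorm (δ s b : ℝ) (T : 𝓢'(Spacetime, ℂ)) : ℝ≥0∞ :=
  ⨅ (g : Spacetime → ℂ) (_ : HasFourier T g),
    eLpNorm (fun z => ((bracket (z 1) ^ s * bracket (z 0 - dispersion δ (z 1)) ^ b : ℝ) : ℂ) * g z)
      2 volume

/-- `W = S T` is the pointwise product of two square integrable functions `S`, `T` on space-time
(an integrable function). -/
def IsProduct (S T W : 𝓢'(Spacetime, ℂ)) : Prop :=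
  ∃ f g : Spacetime → ℂ, MemLp f 2 volume ∧ MemLp g 2 volume ∧
    IsGivenBy S f ∧ IsGivenBy T g ∧ IsGivenBy W (fun z => f z * g z)

/-- The distributional derivative `∂_x T`. -/
def dx (T : 𝓢'(Spacetime, ℂ)) : 𝓢'(Spacetime, ℂ) :=
  ∂_{(EuclideanSpace.single (1 : Fin 2) (1 : ℝ) : Spacetime)} T

end ScaledILW

end

namespace ScaledILW

/-! On the Fourier side the product is a convolution, and `bracket_add_rpow_le` moves the weight
⟨ξ⟩^s onto one factor. Cauchy–Schwarz inside the convolution, followed by Tonelli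
(`lintegral_conv_sq_le`), reduces the estimate to a bound, uniform in δ, τ and low ξ, for ξ² ⟨τ -
p_δ(ξ)⟩^{2(b'-1)} ∫∫ ⟨τ₁ - p_δ(η)⟩^{-2b} ⟨τ - τ₁ - p_δ(ξ-η)⟩^{-2b} dτ₁ dη, where |η|, |ξ-η| ≤ δ⁻¹.
Since 2b > 1, the τ₁ integral leaves (1 + |τ - p_δ(η) - p_δ(ξ-η)|)^{-2b} up to a constant. With η =
ξ/2 + y and A = τ - 2p_δ(ξ/2) the phase is A - R(y), where R is `resonance`.

At low frequencies p_δ behaves like the KdV cubic. As p_δ(ξ) = δ⁻³ p_1(δξ), only p_1 on [-1, 1]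
matters, and there 4x ≤ p_1''(x) ≤ 12x for x > 0. Hence, for ξ > 0, the increments of R are
comparable to those of ξy² (`resonance_slope`). So 1 + |A - R(y)| grows at least linearly in the
distance from |y| to some point a, with slope of order √(ξ(1+|A|)) (`exists_linear_lower_bound`),
and the η integral is O((ξ(1+|A|))^{-1/2}). Finally p_δ(ξ) - 2p_δ(ξ/2) ≥ ξ³/2 gives ξ³ ≤ 2(1+|τ -
p_δ(ξ)|)(1+|A|) (`cube_le_resonance`), which absorbs the factor ξ² once b' - 1 ≤ -1/4.

To transfer this to distributions, the Fourier transform of a product of L² functions is identified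
with the convolution by density of Schwartz functions (`fourier_productDistribution`). -/

/-! ### The dispersion relation -/

/-- The dispersion relation for `δ = 1`. -/
noncomputable def unitDispersion (x : ℝ) : ℝ := 3 * (x ^ 2 * (Real.cosh x / Real.sinh x) - x)

/-- The numerator of the derivative of `unitDispersion`. -/
noncomputable def unitNumer (x : ℝ) : ℝ :=
  2 * x * Real.cosh x * Real.sinh x - x ^ 2 - Real.sinh x ^ 2

/-- The derivative of `unitDispersion`. -/
noncomputable def unitDispersionDeriv (x : ℝ) : ℝ := 3 * (unitNumer x / Real.sinh x ^ 2)

theorem hasDerivAt_unitDispersion_zero : HasDerivAt unitDispersion 0 0 := by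
  rw [hasDerivAt_iff_tendsto_slope]
  have h1 : Filter.Tendsto (fun x : ℝ => Real.sinh x / x) (nhdsWithin 0 {0}ᶜ) (nhds 1) := by
    have := (Real.hasDerivAt_sinh 0).tendsto_slope
    simp only [Real.cosh_zero] at this
    refine this.congr' ?_
    filter_upwards with x
    simp [slope_def_field]
  have h2 : Filter.Tendsto Real.cosh (nhdsWithin 0 {0}ᶜ) (nhds 1) := by
    have := Real.continuous_cosh.tendsto 0
    rw [Real.cosh_zero] at this
    exact this.mono_left nhdsWithin_le_nhds
  have h3 : Filter.Tendsto (fun x : ℝ => 3 * (Real.cosh x / (Real.sinh x / x) - 1))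
      (nhdsWithin 0 {0}ᶜ) (nhds 0) := by
    have := ((h2.div h1 one_ne_zero).sub_const 1).const_mul 3
    simpa using this
  refine h3.congr' ?_
  filter_upwards [self_mem_nhdsWithin] with x hx
  have hx : x ≠ 0 := hx
  have hs : Real.sinh x ≠ 0 := by simpa using hx
  simp only [slope_def_field, unitDispersion, Real.sinh_zero]
  field_simp
  ring

theorem hasDerivAt_unitDispersion (x : ℝ) :
    HasDerivAt unitDispersion (unitDispersionDeriv x) x := by
  rcases eq_or_ne x 0 with rfl | hx
  -- The convention 0/0 = 0 gives the formula for the derivative its correct value 0 at the origin.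
  · simpa [unitDispersionDeriv, unitNumer] using hasDerivAt_unitDispersion_zero
  have hs : Real.sinh x ≠ 0 := by simpa using hx
  have := ((((hasDerivAt_id x).pow 2).mul
    ((Real.hasDerivAt_cosh x).div (Real.hasDerivAt_sinh x) hs)).sub (hasDerivAt_id x)).const_mul 3
  convert! this using 1
  simp only [unitDispersionDeriv, unitNumer]
  have := Real.cosh_sq x
  simp
  field_simp
  rw [this]
  ring

theorem hasDerivAt_unitNumer (x : ℝ) :
    HasDerivAt unitNumer (4 * x * Real.sinh x ^ 2) x := by
  have := (((((hasDerivAt_id x).const_mul 2).mul (Real.hasDerivAt_cosh x)).mul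
    (Real.hasDerivAt_sinh x)).sub ((hasDerivAt_id x).pow 2)).sub ((Real.hasDerivAt_sinh x).pow 2)
  convert! this using 1
  have := Real.cosh_sq x
  simp
  linear_combination (-2 * x) * this

theorem cosh_le_two {x : ℝ} (hx : |x| ≤ 1) : Real.cosh x ≤ 2 := by
  have h1 : Real.cosh x ≤ Real.cosh 1 := by
    rw [Real.cosh_le_cosh]; simpa using hx
  have h2 : Real.cosh 1 ≤ 2 := by
    rw [Real.cosh_eq]
    have := Real.exp_one_lt_d9
    have h3 : Real.exp (-1) ≤ 1 := by simp
    linarith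
  linarith

theorem unitNumer_nonneg {x : ℝ} (hx : 0 ≤ x) : 0 ≤ unitNumer x := by
  have hm : MonotoneOn unitNumer (Set.Ici 0) := by
    refine monotoneOn_of_hasDerivWithinAt_nonneg (convex_Ici 0)
      (fun x _ => (hasDerivAt_unitNumer x).continuousAt.continuousWithinAt)
      (fun x _ => (hasDerivAt_unitNumer x).hasDerivWithinAt) ?_
    intro x hx
    rw [interior_Ici] at hx
    have : 0 < x := hx
    positivity
  have := hm (Set.mem_Ici.2 le_rfl) (Set.mem_Ici.2 hx) hx
  simpa [unitNumer] using this

/-- Clearing the denominator, `unitNumer` is compared with k x² sinh² x for k = 2/3 and k = 2. Both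
sides vanish at 0, so the sign of the derivative of the difference decides; for k = 2/3 this is y
cosh y ≤ 2 sinh y, from cosh y ≤ 2 and y ≤ sinh y. -/
theorem unitDispersionDeriv_bounds {x : ℝ} (hx : 0 < x) (hx1 : x ≤ 1) :
    2 * x ^ 2 ≤ unitDispersionDeriv x ∧ unitDispersionDeriv x ≤ 6 * x ^ 2 := by
  have hs : 0 < Real.sinh x := Real.sinh_pos_iff.2 hx
  have hd (k : ℝ) (y : ℝ) : HasDerivAt (fun y => unitNumer y - k * (y ^ 2 * Real.sinh y ^ 2))
      (4 * y * Real.sinh y ^ 2 - k * (2 * y * Real.sinh y ^ 2 +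
        y ^ 2 * (2 * Real.sinh y * Real.cosh y))) y := by
    have := (hasDerivAt_unitNumer y).sub
      ((((hasDerivAt_id y).pow 2).mul ((Real.hasDerivAt_sinh y).pow 2)).const_mul k)
    convert! this using 1
    simp
  constructor
  · have hm : MonotoneOn (fun y => unitNumer y - 2 / 3 * (y ^ 2 * Real.sinh y ^ 2))
        (Set.Icc 0 1) := by
      refine monotoneOn_of_hasDerivWithinAt_nonneg (convex_Icc 0 1)
        (fun x _ => (hd _ x).continuousAt.continuousWithinAt)
        (fun x _ => (hd _ x).hasDerivWithinAt) ?_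
      intro y hy
      rw [interior_Icc] at hy
      obtain ⟨hy0, hy1⟩ := hy
      have hc := cosh_le_two (x := y) (by rw [abs_of_pos hy0]; exact hy1.le)
      have hys : y ≤ Real.sinh y := Real.self_le_sinh_iff.2 hy0.le
      have hsp : 0 < Real.sinh y := Real.sinh_pos_iff.2 hy0
      have : 4 * y * Real.sinh y ^ 2 - 2 / 3 * (2 * y * Real.sinh y ^ 2 +
        y ^ 2 * (2 * Real.sinh y * Real.cosh y)) =
        4 / 3 * y * Real.sinh y * (2 * Real.sinh y - y * Real.cosh y) := by ring
      rw [this]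
      have : 0 ≤ 2 * Real.sinh y - y * Real.cosh y := by nlinarith
      positivity
    have := hm (Set.mem_Icc.2 ⟨le_rfl, zero_le_one⟩) (Set.mem_Icc.2 ⟨hx.le, hx1⟩) hx.le
    simp [unitNumer] at this
    rw [unitDispersionDeriv, unitNumer, ← mul_div_assoc, le_div_iff₀ (by positivity)]
    linarith
  · have hm : AntitoneOn (fun y => unitNumer y - 2 * (y ^ 2 * Real.sinh y ^ 2))
        (Set.Icc 0 1) := by
      refine antitoneOn_of_hasDerivWithinAt_nonpos (convex_Icc 0 1)
        (fun x _ => (hd _ x).continuousAt.continuousWithinAt)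
        (fun x _ => (hd _ x).hasDerivWithinAt) ?_
      intro y hy
      rw [interior_Icc] at hy
      obtain ⟨hy0, hy1⟩ := hy
      have hsp : 0 < Real.sinh y := Real.sinh_pos_iff.2 hy0
      have : 0 < Real.cosh y := Real.cosh_pos y
      have : 0 ≤ 2 * (y ^ 2 * (2 * Real.sinh y * Real.cosh y)) := by positivity
      linarith
    have := hm (Set.mem_Icc.2 ⟨le_rfl, zero_le_one⟩) (Set.mem_Icc.2 ⟨hx.le, hx1⟩) hx.le
    simp [unitNumer] at this
    rw [unitDispersionDeriv, unitNumer, ← mul_div_assoc, div_le_iff₀ (by positivity)]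
    linarith

theorem hasDerivAt_unitDispersionDeriv {x : ℝ} (hx : 0 < x) :
    HasDerivAt unitDispersionDeriv
      (12 * x - 6 * (unitNumer x * Real.cosh x / Real.sinh x ^ 3)) x := by
  have hs : 0 < Real.sinh x := Real.sinh_pos_iff.2 hx
  have := ((hasDerivAt_unitNumer x).div ((Real.hasDerivAt_sinh x).pow 2)
    (pow_ne_zero 2 hs.ne')).const_mul 3
  convert! this using 1
  simp
  field_simp
  ring

/-- Integrated form of 4y ≤ p_1''(y) ≤ 12y on (0, 1]. The case v = 0 is separate because the formula
for p_1'' is only available for y > 0. -/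
theorem unitDispersionDeriv_sub_bounds {v u : ℝ} (hv : 0 ≤ v) (hvu : v ≤ u) (hu : u ≤ 1) :
    2 * (u ^ 2 - v ^ 2) ≤ unitDispersionDeriv u - unitDispersionDeriv v ∧
      unitDispersionDeriv u - unitDispersionDeriv v ≤ 6 * (u ^ 2 - v ^ 2) := by
  rcases hv.eq_or_lt with rfl | hv
  · rcases hvu.eq_or_lt with rfl | hu0
    · simp
    · have := unitDispersionDeriv_bounds hu0 hu
      simpa [unitDispersionDeriv, unitNumer] using this
  have hd (k : ℝ) {y : ℝ} (hy : 0 < y) : HasDerivAt (fun y => unitDispersionDeriv y - k * y ^ 2)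
      (12 * y - 6 * (unitNumer y * Real.cosh y / Real.sinh y ^ 3) - k * (2 * y)) y := by
    have := (hasDerivAt_unitDispersionDeriv hy).sub (((hasDerivAt_id y).pow 2).const_mul k)
    convert! this using 1
    simp
  constructor
  · have hm : MonotoneOn (fun y => unitDispersionDeriv y - 2 * y ^ 2) (Set.Icc v u) := by
      refine monotoneOn_of_hasDerivWithinAt_nonneg (convex_Icc v u)
        (fun x hx => (hd _ (hv.trans_le hx.1)).continuousAt.continuousWithinAt)
        (fun x hx => (hd _ (hv.trans_le (interior_subset hx).1)).hasDerivWithinAt) ?_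
      intro y hy
      obtain ⟨hy0, hy1⟩ := interior_subset hy
      have hy0 := hv.trans_le hy0
      have hc := cosh_le_two (x := y) (by rw [abs_of_pos hy0]; exact hy1.trans hu)
      have hsp : 0 < Real.sinh y := Real.sinh_pos_iff.2 hy0
      have hcp : 0 < Real.cosh y := Real.cosh_pos y
      have hc1 : 1 ≤ Real.cosh y := Real.one_le_cosh y
      have hsq := Real.cosh_sq y
      have key : 6 * (unitNumer y * Real.cosh y / Real.sinh y ^ 3) ≤ 8 * y := by
        rw [← mul_div_assoc, div_le_iff₀ (by positivity)]
        -- The square is dropped, and sinh² = (cosh - 1)(cosh + 1) ≤ 3(cosh - 1) turns the last term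
        -- into at least 4y sinh³ y.
        have e1 : 12 * y * Real.sinh y ^ 3 - 6 * (unitNumer y * Real.cosh y) =
            6 * (Real.cosh y * (Real.sinh y - y) ^ 2) +
              12 * y * Real.sinh y * (Real.cosh y - 1) := by
          simp only [unitNumer]
          linear_combination (-12 * y * Real.sinh y) * hsq
        have e2 : Real.sinh y ^ 2 ≤ 3 * (Real.cosh y - 1) := by nlinarith
        have e3 : 4 * y * Real.sinh y * Real.sinh y ^ 2 ≤
            4 * y * Real.sinh y * (3 * (Real.cosh y - 1)) := by gcongr
        have e4 : 0 ≤ 6 * (Real.cosh y * (Real.sinh y - y) ^ 2) := by positivity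
        nlinarith
      linarith
    have := hm (Set.left_mem_Icc.2 hvu) (Set.right_mem_Icc.2 hvu) hvu
    simp only at this
    linarith
  · have hm : AntitoneOn (fun y => unitDispersionDeriv y - 6 * y ^ 2) (Set.Icc v u) := by
      refine antitoneOn_of_hasDerivWithinAt_nonpos (convex_Icc v u)
        (fun x hx => (hd _ (hv.trans_le hx.1)).continuousAt.continuousWithinAt)
        (fun x hx => (hd _ (hv.trans_le (interior_subset hx).1)).hasDerivWithinAt) ?_
      intro y hy
      have hy0 := hv.trans_le (interior_subset hy).1
      have hsp : 0 < Real.sinh y := Real.sinh_pos_iff.2 hy0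
      have hcp : 0 < Real.cosh y := Real.cosh_pos y
      have := unitNumer_nonneg hy0.le
      have : 0 ≤ 6 * (unitNumer y * Real.cosh y / Real.sinh y ^ 3) := by positivity
      linarith
    have := hm (Set.left_mem_Icc.2 hvu) (Set.right_mem_Icc.2 hvu) hvu
    simp only at this
    linarith

theorem unitDispersionDeriv_abs (x : ℝ) : unitDispersionDeriv |x| = unitDispersionDeriv x := by
  rcases abs_choice x with h | h <;> rw [h]
  simp [unitDispersionDeriv, unitNumer]

theorem unitDispersion_slope {ξ y y' : ℝ} (hξ : 0 ≤ ξ) (hy : 0 ≤ y) (hyy : y ≤ y')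
    (h1 : ξ / 2 + y' ≤ 1) :
    2 * ξ * (y' ^ 2 - y ^ 2) ≤ (unitDispersion (ξ / 2 + y') + unitDispersion (ξ / 2 - y')) -
        (unitDispersion (ξ / 2 + y) + unitDispersion (ξ / 2 - y)) ∧
      (unitDispersion (ξ / 2 + y') + unitDispersion (ξ / 2 - y')) -
        (unitDispersion (ξ / 2 + y) + unitDispersion (ξ / 2 - y)) ≤
        6 * ξ * (y' ^ 2 - y ^ 2) := by
  have hd (k z : ℝ) : HasDerivAt (fun z => unitDispersion (ξ / 2 + z) +
      unitDispersion (ξ / 2 - z) - k * ξ * z ^ 2)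
      (unitDispersionDeriv (ξ / 2 + z) - unitDispersionDeriv (ξ / 2 - z) - k * ξ * (2 * z)) z := by
    have := (((hasDerivAt_unitDispersion (ξ / 2 + z)).comp z
      ((hasDerivAt_id z).const_add (ξ / 2))).add
      ((hasDerivAt_unitDispersion (ξ / 2 - z)).comp z ((hasDerivAt_id z).const_sub (ξ / 2)))).sub
      (((hasDerivAt_id z).pow 2).const_mul (k * ξ))
    convert! this using 1
    simp
    ring
  have hb {z : ℝ} (hz : z ∈ interior (Set.Icc y y')) :
      4 * ξ * z ≤ unitDispersionDeriv (ξ / 2 + z) - unitDispersionDeriv (ξ / 2 - z) ∧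
      unitDispersionDeriv (ξ / 2 + z) - unitDispersionDeriv (ξ / 2 - z) ≤ 12 * ξ * z := by
    obtain ⟨hz0, hz1⟩ := interior_subset hz
    -- The derivative is even, so ξ/2 - z may be replaced by its absolute value; the squares differ
    -- by (ξ/2 + z)² - (ξ/2 - z)² = 2ξz.
    have := unitDispersionDeriv_sub_bounds (v := |ξ / 2 - z|) (u := ξ / 2 + z) (abs_nonneg _)
      (abs_le.2 ⟨by linarith, by linarith⟩) (by linarith)
    rw [unitDispersionDeriv_abs, sq_abs] at this
    constructor <;> nlinarith
  constructor
  · have hm : MonotoneOn (fun z => unitDispersion (ξ / 2 + z) +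
        unitDispersion (ξ / 2 - z) - 2 * ξ * z ^ 2) (Set.Icc y y') :=
      monotoneOn_of_hasDerivWithinAt_nonneg (convex_Icc y y')
        (fun x _ => (hd _ x).continuousAt.continuousWithinAt)
        (fun x _ => (hd _ x).hasDerivWithinAt) (fun z hz => by linarith [(hb hz).1])
    have := hm (Set.left_mem_Icc.2 hyy) (Set.right_mem_Icc.2 hyy) hyy
    simp only at this
    linarith
  · have hm : AntitoneOn (fun z => unitDispersion (ξ / 2 + z) +
        unitDispersion (ξ / 2 - z) - 6 * ξ * z ^ 2) (Set.Icc y y') :=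
      antitoneOn_of_hasDerivWithinAt_nonpos (convex_Icc y y')
        (fun x _ => (hd _ x).continuousAt.continuousWithinAt)
        (fun x _ => (hd _ x).hasDerivWithinAt) (fun z hz => by linarith [(hb hz).2])
    have := hm (Set.left_mem_Icc.2 hyy) (Set.right_mem_Icc.2 hyy) hyy
    simp only at this
    linarith

theorem dispersion_eq_scaled {δ : ℝ} (hδ : δ ≠ 0) (ξ : ℝ) :
    dispersion δ ξ = unitDispersion (δ * ξ) / δ ^ 3 := by
  simp only [dispersion, if_neg hδ, unitDispersion]
  field_simp

theorem dispersion_neg (δ ξ : ℝ) : dispersion δ (-ξ) = -dispersion δ ξ := by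
  rcases eq_or_ne δ 0 with rfl | h
  · simp only [dispersion, if_true]; ring
  · simp only [dispersion, if_neg h, mul_neg, Real.sinh_neg, Real.cosh_neg]; ring

@[simp] theorem dispersion_zero (δ : ℝ) : dispersion δ 0 = 0 := by
  simp [dispersion]

@[fun_prop] theorem measurable_dispersion (δ : ℝ) : Measurable (dispersion δ) := by
  rcases eq_or_ne δ 0 with rfl | h
  · have : dispersion 0 = fun ξ => ξ ^ 3 := by ext; simp [dispersion]
    rw [this]; fun_prop
  · have : dispersion δ = fun ξ => 3 / δ * (ξ ^ 2 * (Real.cosh (δ * ξ) / Real.sinh (δ * ξ)) -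
      ξ / δ) := by ext; simp [dispersion, h]
    rw [this]; fun_prop

/-- Uniformly in `δ`, the function `y ↦ p_δ(ξ/2 + y) + p_δ(ξ/2 - y)` increases at a rate comparable
to that of `ξ y²` as long as the arguments stay in the low frequency range. -/
theorem dispersion_slope {δ ξ y y' : ℝ} (hδ : 0 ≤ δ) (hξ : 0 ≤ ξ) (hy : 0 ≤ y) (hyy : y ≤ y')
    (h1 : δ = 0 ∨ ξ / 2 + y' ≤ δ⁻¹) :
    2 * ξ * (y' ^ 2 - y ^ 2) ≤ (dispersion δ (ξ / 2 + y') + dispersion δ (ξ / 2 - y')) -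
        (dispersion δ (ξ / 2 + y) + dispersion δ (ξ / 2 - y)) ∧
      (dispersion δ (ξ / 2 + y') + dispersion δ (ξ / 2 - y')) -
        (dispersion δ (ξ / 2 + y) + dispersion δ (ξ / 2 - y)) ≤
        6 * ξ * (y' ^ 2 - y ^ 2) := by
  rcases hδ.eq_or_lt with rfl | hδ
  · have h0 : 0 ≤ ξ * (y' ^ 2 - y ^ 2) := mul_nonneg hξ (by nlinarith)
    simp only [dispersion, if_true]
    constructor <;> nlinarith
  · have h1 := h1.resolve_left hδ.ne'
    have h2 : δ * ξ / 2 + δ * y' ≤ 1 := by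
      have := mul_le_mul_of_nonneg_left h1 hδ.le
      rw [mul_inv_cancel₀ hδ.ne'] at this
      linarith
    have := unitDispersion_slope (ξ := δ * ξ) (y := δ * y) (y' := δ * y') (by positivity)
      (by positivity) (by gcongr) h2
    have e (z : ℝ) : δ * ξ / 2 + δ * z = δ * (ξ / 2 + z) := by ring
    have e' (z : ℝ) : δ * ξ / 2 - δ * z = δ * (ξ / 2 - z) := by ring
    simp only [e, e'] at this
    simp only [dispersion_eq_scaled hδ.ne', ← add_div, ← sub_div]
    rw [le_div_iff₀ (by positivity), div_le_iff₀ (by positivity)]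
    constructor <;> linarith

theorem measurableSet_or_le {α : Type*} [MeasurableSpace α] (δ : ℝ) {f g : α → ℝ}
    (hf : Measurable f) (hg : Measurable g) : MeasurableSet {y | δ = 0 ∨ f y ≤ g y} := by
  by_cases h : δ = 0
  · simp [h]
  · simpa [h] using measurableSet_le hf hg

theorem measurableSet_lowPair (δ ξ : ℝ) :
    MeasurableSet {η : ℝ | (δ = 0 ∨ |η| ≤ δ⁻¹) ∧ (δ = 0 ∨ |ξ - η| ≤ δ⁻¹)} :=
  (measurableSet_or_le (f := fun η : ℝ => |η|) (g := fun _ => δ⁻¹) δ (by fun_prop)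
    (by fun_prop)).inter
    (measurableSet_or_le (f := fun η : ℝ => |ξ - η|) (g := fun _ => δ⁻¹) δ (by fun_prop)
    (by fun_prop))

/-! ### One-dimensional integrals -/

/-- The weight `(1 + |y|)^{-r}`. -/
noncomputable def decay (r y : ℝ) : ℝ≥0∞ := ENNReal.ofReal ((1 + |y|) ^ (-r))

@[fun_prop] theorem measurable_decay (r : ℝ) : Measurable (decay r) := by
  unfold decay; fun_prop

theorem decay_neg (r y : ℝ) : decay r (-y) = decay r y := by simp [decay]

/-- The integral of `decay r`. -/
noncomputable def decayIntegral (r : ℝ) : ℝ≥0∞ := ∫⁻ y, decay r y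

theorem decayIntegral_lt_top {r : ℝ} (hr : 1 < r) : decayIntegral r < ∞ := by
  have := finite_integral_one_add_norm (E := ℝ) (μ := volume) (r := r) (by simpa using hr)
  simpa [decayIntegral, decay, Real.norm_eq_abs] using this

theorem lintegral_comp_mul_sub {κ : ℝ} (hκ : 0 < κ) (a : ℝ) {f : ℝ → ℝ≥0∞} (hf : Measurable f) :
    ∫⁻ y, f (κ * (y - a)) = ENNReal.ofReal κ⁻¹ * ∫⁻ y, f y := by
  rw [lintegral_sub_right_eq_self (fun y => f (κ * y)) a]
  have := Real.map_volume_mul_left hκ.ne'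
  rw [← lintegral_map (f := f) (g := fun y => κ * y) hf (by fun_prop), this,
    lintegral_smul_measure, abs_of_pos (inv_pos.2 hκ), smul_eq_mul]

theorem decay_le_of_le {r M x y : ℝ} (hr : 0 ≤ r) (hM : 0 < M) (h : 1 + |x| ≤ M * (1 + |y|)) :
    decay r y ≤ ENNReal.ofReal (M ^ r) * decay r x := by
  rw [decay, decay, ← ENNReal.ofReal_mul (by positivity)]
  apply ENNReal.ofReal_le_ofReal
  have h1 : (1 + |x|) ^ r ≤ M ^ r * (1 + |y|) ^ r := by
    rw [← Real.mul_rpow hM.le (by positivity)]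
    exact Real.rpow_le_rpow (by positivity) h hr
  rw [Real.rpow_neg (by positivity), Real.rpow_neg (by positivity), ← div_eq_mul_inv,
    inv_eq_one_div, div_le_div_iff₀ (by positivity) (by positivity)]
  linarith

/-- The convolution of two decaying weights. -/
theorem lintegral_decay_mul_decay_le {r : ℝ} (hr : 0 ≤ r) (α β : ℝ) :
    ∫⁻ t, decay r (t - α) * decay r (β - t) ≤
      ENNReal.ofReal (2 ^ r) * 2 * decayIntegral r * decay r (β - α) := by
  have hp (t : ℝ) : decay r (t - α) * decay r (β - t) ≤
      ENNReal.ofReal (2 ^ r) * decay r (β - α) * (decay r (t - α) + decay r (β - t)) := by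
    have htri : |β - α| ≤ |t - α| + |β - t| := by
      have := abs_add_le (t - α) (β - t); rwa [show t - α + (β - t) = β - α by ring] at this
    -- The larger of the two distances is at least |β - α|/2, so its weight comes out of the
    -- integral.
    rcases le_total |t - α| |β - t| with h | h
    · have := decay_le_of_le (x := β - α) (y := β - t) (M := 2) hr two_pos (by linarith)
      calc _ ≤ decay r (t - α) * (ENNReal.ofReal (2 ^ r) * decay r (β - α)) := by gcongr
        _ = ENNReal.ofReal (2 ^ r) * decay r (β - α) * decay r (t - α) := by ring
        _ ≤ _ := by gcongr; exact le_self_add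
    · have := decay_le_of_le (x := β - α) (y := t - α) (M := 2) hr two_pos (by linarith)
      calc _ ≤ (ENNReal.ofReal (2 ^ r) * decay r (β - α)) * decay r (β - t) := by gcongr
        _ ≤ _ := by gcongr; exact le_add_self
  refine (lintegral_mono hp).trans ?_
  rw [lintegral_const_mul _ (by fun_prop), lintegral_add_left (by fun_prop),
    lintegral_sub_right_eq_self (fun t => decay r t), lintegral_sub_left_eq_self (fun t => decay r t)]
  simp only [decayIntegral]
  apply le_of_eq; ring

theorem lintegral_decay_abs_sub_le {κ : ℝ} (hκ : 0 < κ) (r a : ℝ) :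
    ∫⁻ y, decay r (κ * (|y| - a)) ≤ 2 * ENNReal.ofReal κ⁻¹ * decayIntegral r := by
  have hp (y : ℝ) : decay r (κ * (|y| - a)) ≤ decay r (κ * (y - a)) + decay r (κ * (y - (-a))) := by
    rcases abs_choice y with h | h <;> rw [h]
    · exact le_self_add
    · rw [show κ * (-y - a) = -(κ * (y - (-a))) by ring, decay_neg]
      exact le_add_self
  refine (lintegral_mono hp).trans ?_
  rw [lintegral_add_left (by fun_prop), lintegral_comp_mul_sub hκ a (measurable_decay r),
    lintegral_comp_mul_sub hκ (-a) (measurable_decay r)]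
  simp only [decayIntegral]
  apply le_of_eq; ring

/-! ### The resonance function -/

/-- `y ↦ p_δ(ξ/2 + y) + p_δ(ξ/2 - y) - 2 p_δ(ξ/2)`. -/
noncomputable def resonance (δ ξ y : ℝ) : ℝ :=
  dispersion δ (ξ / 2 + y) + dispersion δ (ξ / 2 - y) - 2 * dispersion δ (ξ / 2)

theorem resonance_zero (δ ξ : ℝ) : resonance δ ξ 0 = 0 := by simp [resonance]; ring

theorem resonance_abs (δ ξ y : ℝ) : resonance δ ξ |y| = resonance δ ξ y := by
  rcases abs_choice y with h | h <;> rw [h]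
  simp only [resonance, sub_neg_eq_add, ← sub_eq_add_neg]; ring

theorem continuous_dispersion (δ : ℝ) : Continuous (dispersion δ) := by
  rcases eq_or_ne δ 0 with rfl | h
  · have : dispersion 0 = fun ξ => ξ ^ 3 := by ext; simp [dispersion]
    rw [this]; fun_prop
  · rw [funext (dispersion_eq_scaled h)]
    have : Continuous unitDispersion :=
      continuous_iff_continuousAt.2 fun x => (hasDerivAt_unitDispersion x).continuousAt
    fun_prop

theorem resonance_slope {δ ξ y y' : ℝ} (hδ : 0 ≤ δ) (hξ : 0 ≤ ξ) (hy : 0 ≤ y) (hyy : y ≤ y')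
    (h1 : δ = 0 ∨ ξ / 2 + y' ≤ δ⁻¹) :
    2 * ξ * (y' ^ 2 - y ^ 2) ≤ resonance δ ξ y' - resonance δ ξ y ∧
      resonance δ ξ y' - resonance δ ξ y ≤ 6 * ξ * (y' ^ 2 - y ^ 2) := by
  have := dispersion_slope hδ hξ hy hyy h1
  simp only [resonance]
  constructor <;> linarith

theorem abs_resonance_sub {δ ξ y y' : ℝ} (hδ : 0 ≤ δ) (hξ : 0 ≤ ξ) (hy : 0 ≤ y) (hy' : 0 ≤ y')
    (h1 : δ = 0 ∨ ξ / 2 + y ≤ δ⁻¹) (h1' : δ = 0 ∨ ξ / 2 + y' ≤ δ⁻¹) :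
    2 * ξ * |y ^ 2 - y' ^ 2| ≤ |resonance δ ξ y' - resonance δ ξ y| := by
  rcases le_total y y' with h | h
  · have := (resonance_slope hδ hξ hy h h1').1
    rw [abs_of_nonpos (by nlinarith)]
    exact le_trans (by linarith) (le_abs_self _)
  · have := (resonance_slope hδ hξ hy' h h1).1
    rw [abs_of_nonneg (by nlinarith), abs_sub_comm]
    exact le_trans (by linarith) (le_abs_self _)

/-- A point at which the resonance function takes the value `A`, or beyond the low frequency range
if there is no such point in it. -/
theorem exists_resonance_root {δ ξ A : ℝ} (hδ : 0 ≤ δ) (hξ : 0 < ξ) (h1 : δ = 0 ∨ ξ ≤ δ⁻¹)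
    (hA : 0 < A) :
    ∃ a, 0 ≤ a ∧ A ≤ 6 * ξ * a ^ 2 ∧ ∀ y, 0 ≤ y → (δ = 0 ∨ ξ / 2 + y ≤ δ⁻¹) →
      2 * ξ * |y ^ 2 - a ^ 2| ≤ |A - resonance δ ξ y| := by
  have hroot (L : ℝ) (hL : 0 ≤ L) (hLδ : δ = 0 ∨ ξ / 2 + L ≤ δ⁻¹) (hAL : A ≤ resonance δ ξ L) :
      ∃ a, 0 ≤ a ∧ A ≤ 6 * ξ * a ^ 2 ∧ ∀ y, 0 ≤ y → (δ = 0 ∨ ξ / 2 + y ≤ δ⁻¹) →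
        2 * ξ * |y ^ 2 - a ^ 2| ≤ |A - resonance δ ξ y| := by
    have hc : ContinuousOn (resonance δ ξ) (Set.Icc 0 L) := by
      have := continuous_dispersion δ
      unfold resonance; fun_prop
    obtain ⟨a, ⟨ha0, haL⟩, rfl⟩ := intermediate_value_Icc hL hc
      ⟨by rw [resonance_zero]; exact hA.le, hAL⟩
    have haδ : δ = 0 ∨ ξ / 2 + a ≤ δ⁻¹ := hLδ.imp id fun h => by linarith
    refine ⟨a, ha0, ?_, fun y hy hyδ => abs_resonance_sub hδ hξ.le hy ha0 hyδ haδ⟩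
    have := (resonance_slope hδ hξ.le le_rfl ha0 haδ).2
    rw [resonance_zero] at this
    linarith
  rcases hδ.eq_or_lt with rfl | hδ0
  · refine hroot √(A / (2 * ξ)) (by positivity) (Or.inl rfl) ?_
    -- The endpoint solves 2ξL² = A, so R(L) ≥ A by the lower slope bound.
    have := (resonance_slope (y := 0) (y' := √(A / (2 * ξ))) le_rfl hξ.le le_rfl (by positivity)
      (Or.inl rfl)).1
    rw [resonance_zero, Real.sq_sqrt (by positivity)] at this
    have e : 2 * ξ * (A / (2 * ξ) - 0 ^ 2) = A := by field_simp; ring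
    linarith
  · have h1 := h1.resolve_left hδ0.ne'
    set L := δ⁻¹ - ξ / 2 with hL
    have hL0 : 0 ≤ L := by linarith
    have hLδ : δ = 0 ∨ ξ / 2 + L ≤ δ⁻¹ := Or.inr (by linarith)
    rcases le_or_gt A (resonance δ ξ L) with h | h
    · exact hroot L hL0 hLδ h
    -- R stays below A on the whole range [0, L]. A virtual root a² = L² + e is placed beyond it,
    -- with 6ξe equal to the deficit: then A ≤ 6ξa², and A - R(y) ≥ 6ξe + 2ξ(L² - y²) ≥ 2ξ(a² - y²).
    · set e := (A - resonance δ ξ L) / (6 * ξ) with he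
      have he0 : 0 < e := div_pos (by linarith) (by positivity)
      have hee : 6 * ξ * e = A - resonance δ ξ L := by rw [he]; field_simp
      refine ⟨√(L ^ 2 + e), by positivity, ?_, fun y hy hyδ => ?_⟩
      · have := (resonance_slope hδ hξ.le le_rfl hL0 hLδ).2
        rw [resonance_zero] at this
        rw [Real.sq_sqrt (by positivity)]
        linarith
      · have hyL : y ≤ L := by have := hyδ.resolve_left hδ0.ne'; linarith
        have := (resonance_slope hδ hξ.le hy hyL hLδ).1
        have hsq : y ^ 2 ≤ L ^ 2 := by gcongr
        rw [Real.sq_sqrt (by positivity), abs_of_nonpos (by linarith)]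
        have : 0 ≤ ξ * e := by positivity
        refine le_trans ?_ (le_abs_self _)
        nlinarith

/-- For A ≤ 0 there is no cancellation and a = 0 works. For A > 0 take the root a: |y² - a²| = |y -
a|(y + a) is at least (y - a)², which suffices for A ≤ 1, and at least a|y - a|, which suffices for
A > 1 because A ≤ 6ξa². -/
theorem exists_linear_lower_bound {δ ξ : ℝ} (A : ℝ) (hδ : 0 ≤ δ) (hξ : 0 < ξ)
    (h1 : δ = 0 ∨ ξ ≤ δ⁻¹) :
    ∃ a, ∀ y, 0 ≤ y → (δ = 0 ∨ ξ / 2 + y ≤ δ⁻¹) →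
      √(ξ * (1 + |A|)) / 2 * |y - a| ≤ 1 + |A - resonance δ ξ y| := by
  have hred (y a B : ℝ) (hB : 0 ≤ B) (h : ξ * (1 + |A|) * (y - a) ^ 2 ≤ 4 * B ^ 2) :
      √(ξ * (1 + |A|)) / 2 * |y - a| ≤ B := by
    apply le_of_sq_le_sq _ hB
    rw [mul_pow, div_pow, Real.sq_sqrt (by positivity), sq_abs]
    linarith
  rcases le_or_gt A 0 with hA | hA
  · refine ⟨0, fun y hy hyδ => hred _ _ _ (by positivity) ?_⟩
    have := (resonance_slope hδ hξ.le le_rfl hy hyδ).1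
    rw [resonance_zero] at this
    have h2 : |A| + 2 * ξ * y ^ 2 ≤ |A - resonance δ ξ y| := by
      rw [abs_of_nonpos hA, abs_sub_comm]
      exact le_trans (by linarith) (le_abs_self _)
    have h3 : (1 + |A| + 2 * ξ * y ^ 2) ^ 2 ≤ (1 + |A - resonance δ ξ y|) ^ 2 := by
      exact pow_le_pow_left₀ (by positivity) (by linarith) 2
    have h4 : 0 ≤ |A| := abs_nonneg A
    have h5 : 0 ≤ ξ * y ^ 2 := by positivity
    nlinarith [sq_nonneg (1 + |A| - 2 * (ξ * y ^ 2)), mul_nonneg h4 h5]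
  · obtain ⟨a, ha, haA, hay⟩ := exists_resonance_root hδ hξ h1 hA
    refine ⟨a, fun y hy hyδ => hred _ _ _ (by positivity) ?_⟩
    have h2 := hay y hy hyδ
    set D := |A - resonance δ ξ y| with hD
    have hD0 : 0 ≤ D := abs_nonneg _
    have hfac : |y ^ 2 - a ^ 2| = |y - a| * (y + a) := by
      rw [sq_sub_sq, abs_mul, abs_of_nonneg (by positivity : 0 ≤ y + a), mul_comm]
    rw [hfac] at h2
    have hz : 0 ≤ |y - a| := abs_nonneg _
    rw [← sq_abs (y - a)]
    have hza : |y - a| ≤ y + a := abs_le.2 ⟨by linarith, by linarith⟩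
    set z := |y - a| with hzdef
    rw [abs_of_pos hA]
    rcases le_or_gt A 1 with hA1 | hA1
    · have h3 : 2 * ξ * z ^ 2 ≤ D := by
        refine le_trans ?_ h2
        rw [sq]; gcongr
      have h4 : 0 ≤ ξ * z ^ 2 := by positivity
      nlinarith
    · have h3 : 2 * ξ * a * z ≤ D := by
        refine le_trans ?_ h2
        have : ξ * z * a ≤ ξ * z * (y + a) := by gcongr; linarith
        nlinarith
      have h4 : (2 * ξ * a * z) ^ 2 ≤ D ^ 2 := by gcongr
      have h5 : ξ * z ^ 2 * A ≤ ξ * z ^ 2 * (6 * ξ * a ^ 2) := by gcongr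
      have h6 : ξ * z ^ 2 * 1 ≤ ξ * z ^ 2 * A := by gcongr
      nlinarith

/-- The sublevel estimate for the resonance function in integrated form. -/
theorem lintegral_decay_resonance_le {r δ ξ : ℝ} (A : ℝ) (hr : 0 ≤ r) (hδ : 0 ≤ δ) (hξ : 0 < ξ)
    (h1 : δ = 0 ∨ ξ ≤ δ⁻¹) :
    ∫⁻ y in {y | δ = 0 ∨ ξ / 2 + |y| ≤ δ⁻¹}, decay r (A - resonance δ ξ y) ≤
      ENNReal.ofReal (2 ^ r) * 4 * decayIntegral r * ENNReal.ofReal (√(ξ * (1 + |A|)))⁻¹ := by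
  obtain ⟨a, ha⟩ := exists_linear_lower_bound A hδ hξ h1
  set κ := √(ξ * (1 + |A|)) / 2 with hκ
  have hs : 0 < √(ξ * (1 + |A|)) := Real.sqrt_pos.2 (by positivity)
  have hκ0 : 0 < κ := by positivity
  have hmeas : MeasurableSet {y | δ = 0 ∨ ξ / 2 + |y| ≤ δ⁻¹} :=
    measurableSet_or_le δ (by fun_prop) (by fun_prop)
  calc _ ≤ ∫⁻ y in {y | δ = 0 ∨ ξ / 2 + |y| ≤ δ⁻¹},
        ENNReal.ofReal (2 ^ r) * decay r (κ * (|y| - a)) := by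
        refine setLIntegral_mono' hmeas fun y hy => decay_le_of_le hr two_pos ?_
        have := ha |y| (abs_nonneg y) hy
        rw [resonance_abs] at this
        rw [abs_mul, abs_of_pos hκ0]
        have := abs_nonneg (A - resonance δ ξ y)
        linarith
    _ ≤ ∫⁻ y, ENNReal.ofReal (2 ^ r) * decay r (κ * (|y| - a)) := setLIntegral_le_lintegral _ _
    _ ≤ ENNReal.ofReal (2 ^ r) * (2 * ENNReal.ofReal κ⁻¹ * decayIntegral r) := by
        rw [lintegral_const_mul _ (by fun_prop)]
        gcongr
        exact lintegral_decay_abs_sub_le hκ0 r a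
    _ = _ := by
        have : ENNReal.ofReal κ⁻¹ = 2 * ENNReal.ofReal (√(ξ * (1 + |A|)))⁻¹ := by
          rw [hκ, inv_div, div_eq_mul_inv, ENNReal.ofReal_mul two_pos.le]; simp
        rw [this]; ring

/-- Since p_δ(0) = 0, the resonance function at y = ξ/2 equals p_δ(ξ) - 2p_δ(ξ/2), which is at least
2ξ(ξ/2)² = ξ³/2. By the triangle inequality τ cannot be close to both p_δ(ξ) and 2p_δ(ξ/2). -/
theorem cube_le_resonance {δ ξ τ : ℝ} (hδ : 0 ≤ δ) (hξ : 0 ≤ ξ) (h1 : δ = 0 ∨ ξ ≤ δ⁻¹) :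
    ξ ^ 3 ≤ 2 * ((1 + |τ - dispersion δ ξ|) * (1 + |τ - 2 * dispersion δ (ξ / 2)|)) := by
  have h := (resonance_slope (y := 0) (y' := ξ / 2) hδ hξ le_rfl (by positivity)
    (h1.imp id fun h => by linarith)).1
  rw [resonance_zero, resonance] at h
  simp only [add_halves, sub_self, dispersion_zero] at h
  have h2 : |dispersion δ ξ - 2 * dispersion δ (ξ / 2)| ≤
      |τ - dispersion δ ξ| + |τ - 2 * dispersion δ (ξ / 2)| := by
    have := abs_sub (τ - 2 * dispersion δ (ξ / 2)) (τ - dispersion δ ξ)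
    rw [show τ - 2 * dispersion δ (ξ / 2) - (τ - dispersion δ ξ) =
      dispersion δ ξ - 2 * dispersion δ (ξ / 2) by ring] at this
    linarith
  have h3 := le_abs_self (dispersion δ ξ - 2 * dispersion δ (ξ / 2))
  have h4 := abs_nonneg (τ - dispersion δ ξ)
  have h5 := abs_nonneg (τ - 2 * dispersion δ (ξ / 2))
  nlinarith [mul_nonneg h4 h5]

theorem lintegral_decay_dispersion_of_pos {r δ ξ : ℝ} (τ : ℝ) (hr : 0 ≤ r) (hδ : 0 ≤ δ)
    (hξ : 0 < ξ) (h1 : δ = 0 ∨ ξ ≤ δ⁻¹) :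
    ENNReal.ofReal (ξ ^ 2 * (√(1 + |τ - dispersion δ ξ|))⁻¹) *
      ∫⁻ η in {η | (δ = 0 ∨ |η| ≤ δ⁻¹) ∧ (δ = 0 ∨ |ξ - η| ≤ δ⁻¹)},
        decay r (τ - dispersion δ η - dispersion δ (ξ - η)) ≤
      ENNReal.ofReal (2 ^ r) * 8 * decayIntegral r := by
  set A := τ - 2 * dispersion δ (ξ / 2) with hA
  set f : ℝ → ℝ≥0∞ := fun η => {η | (δ = 0 ∨ |η| ≤ δ⁻¹) ∧ (δ = 0 ∨ |ξ - η| ≤ δ⁻¹)}.indicator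
    (fun η => decay r (τ - dispersion δ η - dispersion δ (ξ - η))) η with hf
  have hS : MeasurableSet {η | (δ = 0 ∨ |η| ≤ δ⁻¹) ∧ (δ = 0 ∨ |ξ - η| ≤ δ⁻¹)} :=
    measurableSet_lowPair δ ξ
  have hmeas : MeasurableSet {y | δ = 0 ∨ ξ / 2 + |y| ≤ δ⁻¹} :=
    measurableSet_or_le δ (by fun_prop) (by fun_prop)
  have hint : ∫⁻ η in {η | (δ = 0 ∨ |η| ≤ δ⁻¹) ∧ (δ = 0 ∨ |ξ - η| ≤ δ⁻¹)},
        decay r (τ - dispersion δ η - dispersion δ (ξ - η)) =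
      ∫⁻ y in {y | δ = 0 ∨ ξ / 2 + |y| ≤ δ⁻¹}, decay r (A - resonance δ ξ y) := by
    rw [← lintegral_indicator hS, ← lintegral_indicator hmeas,
      ← lintegral_add_left_eq_self _ (ξ / 2)]
    refine lintegral_congr fun y => ?_
    -- The two constraints |ξ/2 ± y| ≤ δ⁻¹ amount to ξ/2 + |y| ≤ δ⁻¹, as ξ > 0.
    have hiff : (ξ / 2 + y ∈ {η | (δ = 0 ∨ |η| ≤ δ⁻¹) ∧ (δ = 0 ∨ |ξ - η| ≤ δ⁻¹)}) ↔
        y ∈ {y | δ = 0 ∨ ξ / 2 + |y| ≤ δ⁻¹} := by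
      simp only [Set.mem_ofPred_eq, ← or_and_left]
      refine or_congr Iff.rfl ?_
      rw [show ξ - (ξ / 2 + y) = ξ / 2 - y by ring]
      constructor
      · rintro ⟨h2, h3⟩
        have h2 := (abs_le.1 h2).2
        have h3 := (abs_le.1 h3).2
        rcases abs_choice y with h | h <;> rw [h] <;> linarith
      · intro h
        have h2 := neg_abs_le y
        have h3 := le_abs_self y
        exact ⟨abs_le.2 ⟨by linarith, by linarith⟩, abs_le.2 ⟨by linarith, by linarith⟩⟩
    simp only [Set.indicator_apply, hiff]
    congr 2
    rw [hA, resonance, show ξ - (ξ / 2 + y) = ξ / 2 - y by ring]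
    ring
  rw [hint]
  refine (mul_le_mul_right (lintegral_decay_resonance_le A hr hδ hξ h1) _).trans ?_
  have hcube := cube_le_resonance (τ := τ) hδ hξ.le h1
  rw [← hA] at hcube
  set B := 1 + |τ - dispersion δ ξ| with hB
  have hB0 : 0 < B := by positivity
  -- After squaring this is ξ⁴ ≤ 4Bξ(1+|A|), a consequence of `cube_le_resonance` multiplied by ξ.
  have hreal : ξ ^ 2 * (√B)⁻¹ * (√(ξ * (1 + |A|)))⁻¹ ≤ 2 := by
    rw [mul_assoc, ← mul_inv, ← Real.sqrt_mul hB0.le, ← div_eq_mul_inv,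
      div_le_iff₀ (Real.sqrt_pos.2 (by positivity))]
    apply le_of_sq_le_sq _ (by positivity)
    rw [mul_pow, Real.sq_sqrt (by positivity)]
    have := mul_le_mul_of_nonneg_left hcube hξ.le
    have h0 : 0 ≤ ξ * (B * (1 + |A|)) := by positivity
    nlinarith
  calc _ = ENNReal.ofReal (2 ^ r) * 4 * decayIntegral r *
        ENNReal.ofReal (ξ ^ 2 * (√B)⁻¹ * (√(ξ * (1 + |A|)))⁻¹) := by
        rw [ENNReal.ofReal_mul (p := ξ ^ 2 * (√B)⁻¹) (by positivity)]; ring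
    _ ≤ ENNReal.ofReal (2 ^ r) * 4 * decayIntegral r * ENNReal.ofReal 2 := by gcongr
    _ = _ := by
        rw [ENNReal.ofReal_ofNat]; ring

theorem lintegral_decay_dispersion_le {r δ ξ : ℝ} (τ : ℝ) (hr : 0 ≤ r) (hδ : 0 ≤ δ)
    (h1 : δ = 0 ∨ |ξ| ≤ δ⁻¹) :
    ENNReal.ofReal (ξ ^ 2 * (√(1 + |τ - dispersion δ ξ|))⁻¹) *
      ∫⁻ η in {η | (δ = 0 ∨ |η| ≤ δ⁻¹) ∧ (δ = 0 ∨ |ξ - η| ≤ δ⁻¹)},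
        decay r (τ - dispersion δ η - dispersion δ (ξ - η)) ≤
      ENNReal.ofReal (2 ^ r) * 8 * decayIntegral r := by
  rcases lt_trichotomy ξ 0 with h | rfl | h
  -- As p_δ is odd, the reflection (τ, ξ, η) ↦ (-τ, -ξ, -η) reduces to ξ > 0.
  · have := lintegral_decay_dispersion_of_pos (-τ) hr hδ (neg_pos.2 h)
      (by rwa [abs_of_neg h] at h1)
    convert this using 2
    · rw [dispersion_neg, ← abs_neg (τ - _)]
      congr 2
      · ring
      · congr 4; ring
    · have hS := measurableSet_lowPair δ
      rw [← lintegral_indicator (hS _), ← lintegral_indicator (hS _), ← lintegral_neg_eq_self]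
      refine lintegral_congr fun y => ?_
      have e1 : |-ξ - y| = |ξ - -y| := by rw [← abs_neg]; congr 1; ring
      simp only [Set.indicator_apply, Set.mem_ofPred_eq, abs_neg, e1]
      congr 1
      rw [← decay_neg, show ξ - -y = -(-ξ - y) by ring, dispersion_neg, dispersion_neg]
      congr 1; ring
  · simp
  · exact lintegral_decay_dispersion_of_pos τ hr hδ h (by rwa [abs_of_pos h] at h1)

/-! ### Brackets -/

theorem one_le_bracket (y : ℝ) : 1 ≤ bracket y := by
  rw [bracket, Real.one_le_sqrt]; nlinarith [sq_nonneg y]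

theorem bracket_pos (y : ℝ) : 0 < bracket y := one_pos.trans_le (one_le_bracket y)

@[fun_prop] theorem measurable_bracket : Measurable bracket := by
  unfold bracket; fun_prop

theorem one_add_abs_le_bracket_sq (y : ℝ) : (1 + |y|) ^ 2 ≤ 2 * bracket y ^ 2 := by
  rw [bracket, Real.sq_sqrt (by positivity), ← sq_abs y]
  nlinarith [sq_nonneg (1 - |y|)]

theorem bracket_rpow_neg_sq_le {b : ℝ} (hb : 0 ≤ b) (y : ℝ) :
    ENNReal.ofReal (bracket y ^ (-b)) ^ 2 ≤ ENNReal.ofReal (2 ^ b) * decay (2 * b) y := by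
  have hB := bracket_pos y
  rw [← ENNReal.ofReal_pow (by positivity), decay, ← ENNReal.ofReal_mul (by positivity)]
  apply ENNReal.ofReal_le_ofReal
  rw [Real.rpow_neg (by positivity), Real.rpow_neg (by positivity), inv_pow,
    ← Real.rpow_mul_natCast hB.le, mul_comm b, Nat.cast_ofNat,
    Real.rpow_mul hB.le, Real.rpow_mul (x := 1 + |y|) (by positivity), ← div_eq_mul_inv, inv_eq_one_div,
    div_le_div_iff₀ (by positivity) (by positivity), one_mul,
    ← Real.mul_rpow (by positivity) (by positivity)]
  refine Real.rpow_le_rpow (by positivity) ?_ hb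
  have := one_add_abs_le_bracket_sq y
  norm_cast at *

/-- Applied with c = b' - 1: the threshold -1/4 makes the squared weight O((1+|y|)^{-1/2}), the
power that `cube_le_resonance` requires. -/
theorem bracket_rpow_sq_le {c : ℝ} (hc : c ≤ -(1 / 4)) (y : ℝ) :
    (bracket y ^ c) ^ 2 ≤ 2 * (√(1 + |y|))⁻¹ := by
  have hB := bracket_pos y
  have h1 : (bracket y ^ c) ^ 2 ≤ (√(bracket y))⁻¹ := by
    rw [← Real.rpow_mul_natCast hB.le, Real.sqrt_eq_rpow, ← Real.rpow_neg hB.le]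
    exact Real.rpow_le_rpow_of_exponent_le (one_le_bracket y) (by push_cast; linarith)
  refine h1.trans ?_
  have h2 : √(1 + |y|) ≤ 2 * √(bracket y) := by
    rw [show (2 : ℝ) = √4 by rw [show (4 : ℝ) = 2 ^ 2 by norm_num, Real.sqrt_sq two_pos.le],
      ← Real.sqrt_mul (by norm_num)]
    apply Real.sqrt_le_sqrt
    apply le_of_sq_le_sq _ (by positivity)
    have := one_add_abs_le_bracket_sq y
    nlinarith
  rw [← div_eq_mul_inv, inv_eq_one_div, div_le_div_iff₀ (by positivity) (by positivity)]
  linarith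

theorem bracket_add_le (x y : ℝ) : bracket (x + y) ≤ bracket x + bracket y := by
  have hx := bracket_pos x
  have hy := bracket_pos y
  apply le_of_sq_le_sq _ (by positivity)
  have e (z : ℝ) : bracket z ^ 2 = 1 + z ^ 2 := Real.sq_sqrt (by positivity)
  have h1 : |x| ≤ bracket x := Real.le_sqrt_of_sq_le (by rw [sq_abs]; linarith)
  have h2 : |y| ≤ bracket y := Real.le_sqrt_of_sq_le (by rw [sq_abs]; linarith)
  have h3 : x * y ≤ bracket x * bracket y := by
    calc x * y ≤ |x * y| := le_abs_self _
      _ = |x| * |y| := abs_mul x y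
      _ ≤ _ := by gcongr
  nlinarith [e x, e y, e (x + y)]

/-- A fractional Leibniz rule for the bracket. -/
theorem bracket_add_rpow_le {s : ℝ} (hs : 0 ≤ s) (x y : ℝ) :
    bracket (x + y) ^ s ≤ 2 ^ s * (bracket x ^ s + bracket y ^ s) := by
  have hx := bracket_pos x
  have hy := bracket_pos y
  have hxs : 0 ≤ bracket x ^ s := by positivity
  have hys : 0 ≤ bracket y ^ s := by positivity
  have h := bracket_add_le x y
  have h2 : (0 : ℝ) ≤ 2 ^ s := by positivity
  rcases le_total (bracket x) (bracket y) with hxy | hxy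
  · calc _ ≤ (2 * bracket y) ^ s :=
          Real.rpow_le_rpow (bracket_pos _).le (by linarith) hs
      _ = 2 ^ s * bracket y ^ s := Real.mul_rpow two_pos.le hy.le
      _ ≤ _ := by gcongr; linarith
  · calc _ ≤ (2 * bracket x) ^ s :=
          Real.rpow_le_rpow (bracket_pos _).le (by linarith) hs
      _ = 2 ^ s * bracket x ^ s := Real.mul_rpow two_pos.le hx.le
      _ ≤ _ := by gcongr; linarith

/-! ### The bilinear estimate -/

theorem measurableSet_lowFreq (δ : ℝ) : MeasurableSet (lowFreq δ) :=
  measurableSet_or_le (f := fun z : Spacetime => |z 1|) (g := fun _ => δ⁻¹) δ (by fun_prop)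
    (by fun_prop)

theorem lintegral_spacetime {f : Spacetime → ℝ≥0∞} (hf : Measurable f) :
    ∫⁻ z, f z = ∫⁻ η : ℝ, ∫⁻ t : ℝ, f !₂[t, η] := by
  have h1 := (PiLp.volume_preserving_toLp (Fin 2)).lintegral_comp hf
  have h2 := (volume_preserving_finTwoArrow ℝ).symm.lintegral_comp
    (f := fun x : Fin 2 → ℝ => f (WithLp.toLp 2 x))
    (hf.comp (PiLp.volume_preserving_toLp (Fin 2)).measurable)
  rw [← h1, ← h2, Measure.volume_eq_prod, lintegral_prod_symm]
  · rfl
  · exact (hf.comp (PiLp.volume_preserving_toLp (Fin 2)).measurable).comp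
      (MeasurableEquiv.measurable _) |>.aemeasurable

/-- For fixed η the time integral is a convolution of two weights centred at p_δ(η) and τ -
p_δ(ξ-η); what remains is the one-dimensional integral in η. -/
theorem lintegral_kernel_le {r δ : ℝ} (hr : 0 ≤ r) (hδ : 0 ≤ δ) {z : Spacetime}
    (hz : z ∈ lowFreq δ) :
    ENNReal.ofReal (z 1 ^ 2 * (√(1 + |z 0 - dispersion δ (z 1)|))⁻¹) *
      ∫⁻ ζ : Spacetime, (lowFreq δ).indicator (fun ζ => decay r (ζ 0 - dispersion δ (ζ 1))) ζ *
        (lowFreq δ).indicator (fun ζ => decay r (ζ 0 - dispersion δ (ζ 1))) (z - ζ) ≤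
      ENNReal.ofReal (2 ^ r) * 2 * decayIntegral r *
        (ENNReal.ofReal (2 ^ r) * 8 * decayIntegral r) := by
  set S : Set ℝ := {η | (δ = 0 ∨ |η| ≤ δ⁻¹) ∧ (δ = 0 ∨ |z 1 - η| ≤ δ⁻¹)} with hS
  have hmS : MeasurableSet S := measurableSet_lowPair δ (z 1)
  have hm : Measurable ((lowFreq δ).indicator
      (fun ζ : Spacetime => decay r (ζ 0 - dispersion δ (ζ 1)))) :=
    Measurable.indicator (by fun_prop) (measurableSet_lowFreq δ)
  have hle : ∫⁻ ζ : Spacetime,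
      (lowFreq δ).indicator (fun ζ => decay r (ζ 0 - dispersion δ (ζ 1))) ζ *
        (lowFreq δ).indicator (fun ζ => decay r (ζ 0 - dispersion δ (ζ 1))) (z - ζ) ≤
      ENNReal.ofReal (2 ^ r) * 2 * decayIntegral r *
        ∫⁻ η in S, decay r (z 0 - dispersion δ η - dispersion δ (z 1 - η)) := by
    rw [lintegral_spacetime (f := fun ζ =>
      (lowFreq δ).indicator (fun ζ => decay r (ζ 0 - dispersion δ (ζ 1))) ζ *
        (lowFreq δ).indicator (fun ζ => decay r (ζ 0 - dispersion δ (ζ 1))) (z - ζ))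
      (hm.mul (hm.comp (measurable_const.sub measurable_id)))]
    rw [← lintegral_const_mul _ (by fun_prop), ← lintegral_indicator hmS]
    refine lintegral_mono fun η => ?_
    by_cases hη : η ∈ S
    · rw [Set.indicator_of_mem hη]
      refine le_trans ?_ ((lintegral_decay_mul_decay_le hr (dispersion δ η)
        (z 0 - dispersion δ (z 1 - η))).trans_eq ?_)
      · refine lintegral_mono fun t => ?_
        refine mul_le_mul' ?_ ?_
        · exact (Set.indicator_le_self _ _ _).trans_eq (by simp)
        · refine (Set.indicator_le_self _ _ _).trans_eq ?_
          simp only [PiLp.sub_apply, Matrix.cons_val_zero, Matrix.cons_val_one]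
          congr 1; ring
      · congr 2; ring
    · rw [Set.indicator_of_notMem hη]
      refine le_of_eq ((lintegral_congr fun t => ?_).trans lintegral_zero)
      by_cases h1 : (!₂[t, η] : Spacetime) ∈ lowFreq δ
      · have h2 : z - (!₂[t, η] : Spacetime) ∉ lowFreq δ := fun h2 => hη ⟨h1, h2⟩
        rw [Set.indicator_of_notMem h2, mul_zero]
      · rw [Set.indicator_of_notMem h1, zero_mul]
  have := lintegral_decay_dispersion_le (z 0) hr hδ (ξ := z 1) hz
  calc _ ≤ _ := mul_le_mul_right hle _
    _ = ENNReal.ofReal (2 ^ r) * 2 * decayIntegral r *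
        (ENNReal.ofReal (z 1 ^ 2 * (√(1 + |z 0 - dispersion δ (z 1)|))⁻¹) *
          ∫⁻ η in S, decay r (z 0 - dispersion δ η - dispersion δ (z 1 - η))) := by ring
    _ ≤ _ := by gcongr

/-- The modulation weight `⟨τ - p_δ(ξ)⟩^b`. -/
noncomputable def modWeight (δ b : ℝ) (z : Spacetime) : ℝ≥0∞ :=
  ENNReal.ofReal (bracket (z 0 - dispersion δ (z 1)) ^ b)

@[fun_prop] theorem measurable_modWeight (δ b : ℝ) : Measurable (modWeight δ b) := by
  unfold modWeight; fun_prop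

theorem modWeight_neg_mul (δ b : ℝ) (z : Spacetime) :
    modWeight δ (-b) z * modWeight δ b z = 1 := by
  have := bracket_pos (z 0 - dispersion δ (z 1))
  rw [modWeight, modWeight, ← ENNReal.ofReal_mul (by positivity), ← Real.rpow_add this]
  simp

theorem lintegral_mul_sq_le {α : Type*} [MeasurableSpace α] {μ : Measure α} {f g : α → ℝ≥0∞}
    (hf : Measurable f) (hg : Measurable g) :
    (∫⁻ x, f x * g x ∂μ) ^ 2 ≤ (∫⁻ x, f x ^ 2 ∂μ) * ∫⁻ x, g x ^ 2 ∂μ := by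
  have h := ENNReal.lintegral_mul_le_Lp_mul_Lq μ Real.HolderConjugate.two_two hf.aemeasurable
    hg.aemeasurable
  have h2 := pow_le_pow_left' h 2
  rw [mul_pow, ← ENNReal.rpow_mul_natCast, ← ENNReal.rpow_mul_natCast] at h2
  simpa using h2

/-- Cauchy–Schwarz against the kernel k(ζ)k(z - ζ), with k the inverse modulation weight cut off to
low frequencies. The kernel integral is bounded uniformly in z, and the remaining double integral
factorizes by Tonelli and translation invariance. -/
theorem lintegral_conv_sq_le {b c δ : ℝ} (hb : 0 ≤ b) (hc : c ≤ -(1 / 4)) (hδ : 0 ≤ δ)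
    {F₁ F₂ : Spacetime → ℝ≥0∞} (hF₁ : Measurable F₁) (hF₂ : Measurable F₂)
    (h₁ : ∀ z ∉ lowFreq δ, F₁ z = 0) (h₂ : ∀ z ∉ lowFreq δ, F₂ z = 0) :
    ∫⁻ z in lowFreq δ, (ENNReal.ofReal |z 1| * modWeight δ c z * ∫⁻ ζ, F₁ ζ * F₂ (z - ζ)) ^ 2 ≤
      2 * ENNReal.ofReal (2 ^ b) ^ 2 * (ENNReal.ofReal (2 ^ (2 * b)) * 2 * decayIntegral (2 * b) *
        (ENNReal.ofReal (2 ^ (2 * b)) * 8 * decayIntegral (2 * b))) *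
      ((∫⁻ z, (modWeight δ b z * F₁ z) ^ 2) * ∫⁻ z, (modWeight δ b z * F₂ z) ^ 2) := by
  set K := ENNReal.ofReal (2 ^ (2 * b)) * 2 * decayIntegral (2 * b) *
        (ENNReal.ofReal (2 ^ (2 * b)) * 8 * decayIntegral (2 * b)) with hK
  set k : Spacetime → ℝ≥0∞ := (lowFreq δ).indicator (modWeight δ (-b)) with hk
  have hkm : Measurable k := (measurable_modWeight δ (-b)).indicator (measurableSet_lowFreq δ)
  have hkF {F : Spacetime → ℝ≥0∞} (h : ∀ z ∉ lowFreq δ, F z = 0) (z : Spacetime) :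
      F z = k z * (modWeight δ b z * F z) := by
    by_cases hz : z ∈ lowFreq δ
    · rw [hk, Set.indicator_of_mem hz, ← mul_assoc, modWeight_neg_mul, one_mul]
    · simp [h z hz]
  have hksq (z : Spacetime) : k z ^ 2 ≤ ENNReal.ofReal (2 ^ b) *
      (lowFreq δ).indicator (fun ζ => decay (2 * b) (ζ 0 - dispersion δ (ζ 1))) z := by
    by_cases hz : z ∈ lowFreq δ
    · rw [hk, Set.indicator_of_mem hz, Set.indicator_of_mem hz]
      exact bracket_rpow_neg_sq_le hb _
    · rw [hk, Set.indicator_of_notMem hz]; simp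
  have hpt {z : Spacetime} (hz : z ∈ lowFreq δ) :
      (ENNReal.ofReal |z 1| * modWeight δ c z * ∫⁻ ζ, F₁ ζ * F₂ (z - ζ)) ^ 2 ≤
      2 * ENNReal.ofReal (2 ^ b) ^ 2 * K * ∫⁻ ζ, (modWeight δ b ζ * F₁ ζ) ^ 2 *
        (modWeight δ b (z - ζ) * F₂ (z - ζ)) ^ 2 := by
    have hcs : (∫⁻ ζ, F₁ ζ * F₂ (z - ζ)) ^ 2 ≤ (∫⁻ ζ, (k ζ * k (z - ζ)) ^ 2) *
        ∫⁻ ζ, (modWeight δ b ζ * F₁ ζ) ^ 2 * (modWeight δ b (z - ζ) * F₂ (z - ζ)) ^ 2 := by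
      have := lintegral_mul_sq_le (μ := volume) (f := fun ζ => k ζ * k (z - ζ))
        (g := fun ζ => (modWeight δ b ζ * F₁ ζ) * (modWeight δ b (z - ζ) * F₂ (z - ζ)))
        (by fun_prop) (by fun_prop)
      simp only [mul_pow (modWeight δ b _ * _)] at this
      refine le_trans (le_of_eq ?_) this
      congr 1
      refine lintegral_congr fun ζ => ?_
      calc _ = (k ζ * (modWeight δ b ζ * F₁ ζ)) *
            (k (z - ζ) * (modWeight δ b (z - ζ) * F₂ (z - ζ))) := by rw [← hkF h₁, ← hkF h₂]
        _ = _ := by ring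
    have hkk : ∫⁻ ζ, (k ζ * k (z - ζ)) ^ 2 ≤ ENNReal.ofReal (2 ^ b) ^ 2 *
        ∫⁻ ζ : Spacetime,
          (lowFreq δ).indicator (fun ζ => decay (2 * b) (ζ 0 - dispersion δ (ζ 1))) ζ *
          (lowFreq δ).indicator (fun ζ => decay (2 * b) (ζ 0 - dispersion δ (ζ 1))) (z - ζ) := by
      rw [← lintegral_const_mul' _ _ (by finiteness)]
      refine lintegral_mono fun ζ => ?_
      rw [mul_pow]
      refine (mul_le_mul' (hksq ζ) (hksq (z - ζ))).trans_eq ?_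
      ring
    have hw : (ENNReal.ofReal |z 1| * modWeight δ c z) ^ 2 ≤
        2 * ENNReal.ofReal (z 1 ^ 2 * (√(1 + |z 0 - dispersion δ (z 1)|))⁻¹) := by
      have hB := bracket_pos (z 0 - dispersion δ (z 1))
      have hdouble (x : ℝ) : 2 * ENNReal.ofReal x = ENNReal.ofReal (2 * x) := by
        rw [ENNReal.ofReal_mul two_pos.le, ENNReal.ofReal_ofNat]
      rw [modWeight, ← ENNReal.ofReal_mul (abs_nonneg _), ← ENNReal.ofReal_pow (by positivity),
        hdouble, mul_pow, sq_abs]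
      apply ENNReal.ofReal_le_ofReal
      have := mul_le_mul_of_nonneg_left (bracket_rpow_sq_le hc (z 0 - dispersion δ (z 1)))
        (sq_nonneg (z 1))
      linarith
    have hker := lintegral_kernel_le (r := 2 * b) (by positivity) hδ hz
    rw [mul_pow]
    refine (mul_le_mul' hw (hcs.trans (mul_le_mul_left hkk _))).trans ?_
    rw [show ∀ a b c d e : ℝ≥0∞, a * b * (c * d * e) = a * c * (b * d) * e by intros; ring]
    gcongr
  calc _ ≤ ∫⁻ z in lowFreq δ, 2 * ENNReal.ofReal (2 ^ b) ^ 2 * K *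
        ∫⁻ ζ, (modWeight δ b ζ * F₁ ζ) ^ 2 * (modWeight δ b (z - ζ) * F₂ (z - ζ)) ^ 2 :=
        setLIntegral_mono' (measurableSet_lowFreq δ) fun z hz => hpt hz
    _ ≤ ∫⁻ z, 2 * ENNReal.ofReal (2 ^ b) ^ 2 * K *
        ∫⁻ ζ, (modWeight δ b ζ * F₁ ζ) ^ 2 * (modWeight δ b (z - ζ) * F₂ (z - ζ)) ^ 2 :=
        setLIntegral_le_lintegral _ _
    _ = _ := by
        have hm : Measurable (Function.uncurry fun z ζ : Spacetime =>
            (modWeight δ b ζ * F₁ ζ) ^ 2 * (modWeight δ b (z - ζ) * F₂ (z - ζ)) ^ 2) := by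
          unfold Function.uncurry; fun_prop
        rw [lintegral_const_mul _ hm.lintegral_prod_right, lintegral_lintegral_swap hm.aemeasurable]
        congr 1
        rw [← lintegral_mul_const _ (by fun_prop)]
        refine lintegral_congr fun ζ => ?_
        rw [lintegral_const_mul _ (by fun_prop),
          lintegral_sub_right_eq_self (fun z => (modWeight δ b z * F₂ z) ^ 2) ζ]

/-! ### Convolutions and products of square integrable functions -/

section Convolution

variable {E : Type*} [NormedAddCommGroup E] [InnerProductSpace ℝ E] [FiniteDimensional ℝ E]
  [MeasurableSpace E] [BorelSpace E]

/-- The convolution of two complex-valued functions. -/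
noncomputable def conv (f g : E → ℂ) (x : E) : ℂ := ∫ y, f y * g (x - y)

theorem conv_congr_ae {f f' g g' : E → ℂ} (hf : f =ᵐ[volume] f') (hg : g =ᵐ[volume] g') :
    conv f g = conv f' g' := by
  ext x
  refine integral_congr_ae ?_
  have := (quasiMeasurePreserving_sub_left_of_right_invariant volume x).ae_eq_comp hg
  filter_upwards [hf, this] with y hy hy'
  simp only [Function.comp_apply] at hy'
  rw [hy, hy']

theorem aestronglyMeasurable_conv {f g : E → ℂ} (hf : AEStronglyMeasurable f)
    (hg : AEStronglyMeasurable g) : AEStronglyMeasurable (conv f g) := by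
  have := hf.convolution_integrand (μ := volume) (ContinuousLinearMap.mul ℂ ℂ) hg
  exact this.integral_prod_right'

/-- The reflection and translation `g ↦ g (x - ·)` on `L²`. -/
noncomputable def reflectLp (x : E) (g : Lp (α := E) ℂ 2) : Lp (α := E) ℂ 2 :=
  Lp.compMeasurePreserving (fun y => x - y) (volume.measurePreserving_sub_left x) g

theorem norm_reflectLp (x : E) (g : Lp (α := E) ℂ 2) : ‖reflectLp x g‖ = ‖g‖ :=
  Lp.norm_compMeasurePreserving _ _

theorem continuous_reflectLp (x : E) : Continuous (reflectLp x) :=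
  (Lp.isometry_compMeasurePreserving (volume.measurePreserving_sub_left x)).continuous

theorem conv_eq_lpPairing (f g : Lp (α := E) ℂ 2) (x : E) :
    conv f g x = (ContinuousLinearMap.mul ℂ ℂ).lpPairing volume 2 2 f (reflectLp x g) := by
  rw [ContinuousLinearMap.lpPairing_eq_integral]
  refine integral_congr_ae ?_
  filter_upwards [Lp.coeFn_compMeasurePreserving g (volume.measurePreserving_sub_left x)] with y hy
  simp only [reflectLp, hy, Function.comp_apply, ContinuousLinearMap.mul_apply']

theorem norm_conv_le (f g : Lp (α := E) ℂ 2) (x : E) :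
    ‖conv f g x‖ ≤ ‖(ContinuousLinearMap.mul ℂ ℂ).lpPairing (volume : Measure E) 2 2‖ *
      ‖f‖ * ‖g‖ := by
  rw [conv_eq_lpPairing, ← norm_reflectLp x g]
  exact ContinuousLinearMap.le_opNorm₂ _ _ _

/-- Needed to extend `fourier_productDistribution` from Schwartz functions. Dominated convergence
applies because the sup norm of the convolution is controlled by the two L² norms. -/
theorem continuous_integral_mul_conv (φ : 𝓢(E, ℂ)) :
    Continuous fun p : Lp (α := E) ℂ 2 × Lp (α := E) ℂ 2 => ∫ x, φ x * conv p.1 p.2 x := by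
  refine continuous_iff_continuousAt.2 fun p => ?_
  refine continuousAt_of_dominated
    (bound := fun x => ‖φ x‖ * (‖(ContinuousLinearMap.mul ℂ ℂ).lpPairing
      (volume : Measure E) 2 2‖ * (‖p.1‖ + 1) * (‖p.2‖ + 1))) ?_ ?_ ?_ ?_
  · filter_upwards with q
    exact φ.continuous.aestronglyMeasurable.mul
      (aestronglyMeasurable_conv (Lp.aestronglyMeasurable _) (Lp.aestronglyMeasurable _))
  · have h1 : ∀ᶠ q : Lp (α := E) ℂ 2 × Lp (α := E) ℂ 2 in nhds p, ‖q.1‖ < ‖p.1‖ + 1 :=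
      (continuous_fst.norm.tendsto p).eventually_lt_const (lt_add_one _)
    have h2 : ∀ᶠ q : Lp (α := E) ℂ 2 × Lp (α := E) ℂ 2 in nhds p, ‖q.2‖ < ‖p.2‖ + 1 :=
      (continuous_snd.norm.tendsto p).eventually_lt_const (lt_add_one _)
    filter_upwards [h1, h2] with q hq1 hq2
    filter_upwards with x
    rw [norm_mul]
    gcongr
    refine (norm_conv_le _ _ _).trans ?_
    gcongr
  · exact φ.integrable.norm.mul_const _
  · filter_upwards with x
    simp only [conv_eq_lpPairing]
    have := continuous_reflectLp x
    fun_prop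

/-- The product of two square integrable functions, as a tempered distribution. -/
noncomputable def productDistribution (f g : Lp (α := E) ℂ 2) : 𝓢'(E, ℂ) :=
  Lp.toTemperedDistributionCLM ℂ volume 1
    ((ContinuousLinearMap.mul ℂ ℂ).holderL (volume : Measure E) 2 2 1 f g)

theorem productDistribution_apply (f g : Lp (α := E) ℂ 2) (φ : 𝓢(E, ℂ)) :
    productDistribution f g φ = ∫ x, φ x * (f x * g x) := by
  rw [productDistribution, Lp.toTemperedDistributionCLM_apply, Lp.toTemperedDistribution_apply]
  refine integral_congr_ae ?_
  filter_upwards [(ContinuousLinearMap.mul ℂ ℂ).coeFn_holder (r := 1) f g] with x hx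
  simp only [ContinuousLinearMap.holderL_apply_apply, hx, smul_eq_mul,
    ContinuousLinearMap.mul_apply']

theorem continuous_productDistribution_apply (φ : 𝓢(E, ℂ)) :
    Continuous fun p : Lp (α := E) ℂ 2 × Lp (α := E) ℂ 2 => productDistribution p.1 p.2 φ := by
  have h1 : Continuous fun f : Lp (α := E) ℂ 1 =>
      Lp.toTemperedDistributionCLM ℂ volume 1 f φ :=
    (PointwiseConvergenceCLM.evalCLM (RingHom.id ℂ) ℂ φ).continuous.comp
      (Lp.toTemperedDistributionCLM ℂ volume 1).continuous
  exact h1.comp (by fun_prop : Continuous fun p : Lp (α := E) ℂ 2 × Lp (α := E) ℂ 2 =>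
    (ContinuousLinearMap.mul ℂ ℂ).holderL (volume : Measure E) 2 2 1 p.1 p.2)

theorem fourierInv_convolution_apply (a b : 𝓢(E, ℂ)) (x : E) :
    𝓕⁻ (SchwartzMap.convolution (ContinuousLinearMap.mul ℂ ℂ) a b) x = 𝓕⁻ a x * 𝓕⁻ b x := by
  have h (c : 𝓢(E, ℂ)) : 𝓕⁻ c x = 𝓕 c (-x) := by
    rw [fourierInv_coe, fourier_coe, Real.fourierInv_eq_fourier_neg]
  rw [h, h, h, SchwartzMap.fourier_convolution, pairing_apply_apply]
  rfl

theorem continuous_productDistribution_fourierInv (φ : 𝓢(E, ℂ)) :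
    Continuous fun p : Lp (α := E) ℂ 2 × Lp (α := E) ℂ 2 =>
      productDistribution (𝓕⁻ p.1) (𝓕⁻ p.2) (𝓕 φ) := by
  have hF : Continuous fun f : Lp (α := E) ℂ 2 => 𝓕⁻ f :=
    ContinuousFourierInv.continuous_fourierInv
  have h := continuous_productDistribution_apply (𝓕 φ)
  have h2 : Continuous fun p : Lp (α := E) ℂ 2 × Lp (α := E) ℂ 2 =>
      ((𝓕⁻ p.1 : Lp (α := E) ℂ 2), (𝓕⁻ p.2 : Lp (α := E) ℂ 2)) :=
    (hF.comp continuous_fst).prodMk (hF.comp continuous_snd)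
  have := h.comp h2
  simpa only [Function.comp_def] using this

/-- The Fourier transform of a product of square integrable functions is the convolution of the
Fourier transforms. -/
theorem fourier_productDistribution (f g : Lp (α := E) ℂ 2) (φ : 𝓢(E, ℂ)) :
    (𝓕 (productDistribution (𝓕⁻ f) (𝓕⁻ g)) : 𝓢'(E, ℂ)) φ = ∫ x, φ x * conv f g x := by
  rw [TemperedDistribution.fourier_apply]
  -- Both sides are jointly continuous on L² × L². For Schwartz functions the identity is the
  -- convolution theorem, after moving 𝓕 from φ to the other factor.
  refine DenseRange.induction_on₂ (p := fun f g : Lp (α := E) ℂ 2 =>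
    productDistribution (𝓕⁻ f) (𝓕⁻ g) (𝓕 φ) = ∫ x, φ x * conv f g x)
    (SchwartzMap.denseRange_toLpCLM (E := E) (F := ℂ) (p := 2) (μ := volume) ENNReal.ofNat_ne_top)
    ?_ ?_ f g
  · have h := continuous_productDistribution_fourierInv φ
    exact isClosed_eq h (continuous_integral_mul_conv φ)
  · intro a b
    simp only [toLpCLM_apply, SchwartzMap.toLp_fourierInv_eq]
    rw [productDistribution_apply]
    have h1 : ∫ x, 𝓕 φ x * (((𝓕⁻ a).toLp 2 : Lp (α := E) ℂ 2) x *
        ((𝓕⁻ b).toLp 2 : Lp (α := E) ℂ 2) x) = ∫ x, 𝓕 φ x *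
        𝓕⁻ (SchwartzMap.convolution (ContinuousLinearMap.mul ℂ ℂ) a b) x := by
      refine integral_congr_ae ?_
      filter_upwards [(𝓕⁻ a).coeFn_toLp 2 volume, (𝓕⁻ b).coeFn_toLp 2 volume] with x hx hy
      rw [hx, hy, fourierInv_convolution_apply]
    rw [h1, integral_fourier_mul_eq, fourier_fourierInv_eq]
    refine integral_congr_ae ?_
    filter_upwards with x
    rw [conv_congr_ae (a.coeFn_toLp 2 volume) (b.coeFn_toLp 2 volume),
      SchwartzMap.convolution_apply]
    rfl

end Convolution

/-! ### Functions representing tempered distributions -/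

theorem IsGivenBy.locallyIntegrable {T : 𝓢'(Spacetime, ℂ)} {f : Spacetime → ℂ}
    (h : IsGivenBy T f) : LocallyIntegrable f := by
  intro x
  let φ : ContDiffBump x := ⟨1, 2, one_pos, one_lt_two⟩
  have h1 : HasCompactSupport (Complex.ofRealCLM ∘ φ) := φ.hasCompactSupport.comp_left rfl
  have h2 : ContDiff ℝ ((⊤ : ℕ∞) : WithTop ℕ∞) (Complex.ofRealCLM ∘ φ) :=
    Complex.ofRealCLM.contDiff.comp φ.contDiff
  have h3 := (h (h1.toSchwartzMap h2)).1
  refine ⟨Metric.closedBall x 1, Metric.closedBall_mem_nhds x one_pos, ?_⟩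
  refine h3.integrableOn.congr_fun (fun y hy => ?_) measurableSet_closedBall
  have : φ y = 1 := φ.one_of_mem_closedBall hy
  simp [this]

theorem IsGivenBy.ae_eq {T : 𝓢'(Spacetime, ℂ)} {f g : Spacetime → ℂ}
    (hf : IsGivenBy T f) (hg : IsGivenBy T g) : f =ᵐ[volume] g := by
  refine ae_eq_of_integral_contDiff_smul_eq hf.locallyIntegrable hg.locallyIntegrable ?_
  intro φ hφ hφc
  have h1 : HasCompactSupport (Complex.ofRealCLM ∘ φ) := hφc.comp_left rfl
  have h2 : ContDiff ℝ ((⊤ : ℕ∞) : WithTop ℕ∞) (Complex.ofRealCLM ∘ φ) :=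
    Complex.ofRealCLM.contDiff.comp hφ
  have := (hf (h1.toSchwartzMap h2)).2.symm.trans (hg (h1.toSchwartzMap h2)).2
  simpa [Complex.real_smul] using this

theorem IsGivenBy.congr_ae {T : 𝓢'(Spacetime, ℂ)} {f g : Spacetime → ℂ}
    (hf : IsGivenBy T f) (h : f =ᵐ[volume] g) : IsGivenBy T g := by
  intro φ
  have h' : (fun z => φ z * f z) =ᵐ[volume] fun z => φ z * g z := by
    filter_upwards [h] with z hz
    rw [hz]
  exact ⟨(hf φ).1.congr h', (hf φ).2.trans (integral_congr_ae h')⟩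

theorem isGivenBy_toTemperedDistribution {p : ℝ≥0∞} [Fact (1 ≤ p)]
    (f : Lp (α := Spacetime) ℂ p) : IsGivenBy (Lp.toTemperedDistribution f) f := by
  intro φ
  refine ⟨?_, by simp⟩
  have := ENNReal.HolderConjugate.inv_one_sub_inv' (Fact.out : 1 ≤ p)
  exact (Lp.memLp f).integrable_mul (φ.memLp (1 - p⁻¹)⁻¹) |>.congr (by
    filter_upwards with z
    simp [mul_comm])

theorem ext_of_isGivenBy {S T : 𝓢'(Spacetime, ℂ)} {f : Spacetime → ℂ}
    (hS : IsGivenBy S f) (hT : IsGivenBy T f) : S = T := by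
  ext φ
  rw [(hS φ).2, (hT φ).2]

theorem quasiMeasurePreserving_smul {r : ℝ} (hr : r ≠ 0) :
    Measure.QuasiMeasurePreserving (fun z : Spacetime => r • z) volume volume := by
  refine ⟨by fun_prop, ?_⟩
  rw [Measure.map_addHaar_smul _ hr]
  exact Measure.smul_absolutelyContinuous

theorem two_pi_ne_zero : (2 * Real.pi) ≠ 0 := by positivity

theorem HasFourier.aestronglyMeasurable {T : 𝓢'(Spacetime, ℂ)} {g : Spacetime → ℂ}
    (h : HasFourier T g) : AEStronglyMeasurable g := by
  have h1 := h.locallyIntegrable.aestronglyMeasurable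
  have := h1.comp_quasiMeasurePreserving (quasiMeasurePreserving_smul (inv_ne_zero two_pi_ne_zero))
  refine this.congr (Filter.Eventually.of_forall fun z => ?_)
  simp only [Function.comp_apply, smul_smul, mul_inv_cancel₀ two_pi_ne_zero, one_smul]

theorem HasFourier.ae_eq {T : 𝓢'(Spacetime, ℂ)} {g g' : Spacetime → ℂ}
    (h : HasFourier T g) (h' : HasFourier T g') : g =ᵐ[volume] g' := by
  have := (quasiMeasurePreserving_smul (inv_ne_zero two_pi_ne_zero)).ae_eq_comp
    (IsGivenBy.ae_eq h h')
  filter_upwards [this] with z hz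
  simpa only [Function.comp_apply, smul_smul, mul_inv_cancel₀ two_pi_ne_zero, one_smul] using hz

theorem HasFourier.congr_ae {T : 𝓢'(Spacetime, ℂ)} {g g' : Spacetime → ℂ}
    (h : HasFourier T g) (hg : g =ᵐ[volume] g') : HasFourier T g' :=
  IsGivenBy.congr_ae h ((quasiMeasurePreserving_smul two_pi_ne_zero).ae_eq_comp hg)

/-- The weighted `L²` norm of `g`. -/
noncomputable def weightedNorm (δ s b : ℝ) (g : Spacetime → ℂ) : ℝ≥0∞ :=
  eLpNorm (fun z => ((bracket (z 1) ^ s * bracket (z 0 - dispersion δ (z 1)) ^ b : ℝ) : ℂ) * g z)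
    2 volume

/-- All representatives agree almost everywhere, so the infimum runs over a single value. -/
theorem HasFourier.xNorm_eq {T : 𝓢'(Spacetime, ℂ)} {g : Spacetime → ℂ} (h : HasFourier T g)
    (δ s b : ℝ) : XNorm δ s b T = weightedNorm δ s b g := by
  refine le_antisymm (iInf₂_le g h) (le_iInf₂ fun g' h' => le_of_eq ?_)
  refine eLpNorm_congr_ae ?_
  filter_upwards [h.ae_eq h'] with z hz
  rw [hz]

theorem memLp_comp_smul {p : ℝ≥0∞} {g : Spacetime → ℂ} (hg : MemLp g p) {r : ℝ} (hr : r ≠ 0) :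
    MemLp (fun z => g (r • z)) p := by
  have h1 : MemLp g p (Measure.map (fun z : Spacetime => r • z) volume) := by
    rw [Measure.map_addHaar_smul _ hr]
    exact hg.smul_measure ENNReal.ofReal_ne_top
  exact h1.comp_of_map (by fun_prop)

/-- A tempered distribution with square integrable Fourier transform is the inverse Fourier
transform of it. -/
theorem HasFourier.isGivenBy_fourierInv {T : 𝓢'(Spacetime, ℂ)} {g : Spacetime → ℂ}
    (h : HasFourier T g) {a : Lp (α := Spacetime) ℂ 2}
    (ha : a =ᵐ[volume] fun ω => g ((2 * Real.pi) • ω)) :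
    IsGivenBy T (𝓕⁻ a : Lp (α := Spacetime) ℂ 2 volume) := by
  have h1 : 𝓕 T = Lp.toTemperedDistribution a :=
    ext_of_isGivenBy h ((isGivenBy_toTemperedDistribution _).congr_ae ha)
  have h2 : T = Lp.toTemperedDistribution (𝓕⁻ a : Lp (α := Spacetime) ℂ 2 volume) := by
    rw [← Lp.fourierInv_toTemperedDistribution_eq, ← h1, fourierInv_fourier_eq]
  rw [h2]
  exact isGivenBy_toTemperedDistribution _

theorem isGivenBy_of_bound {T : 𝓢'(Spacetime, ℂ)} {f : Spacetime → ℂ}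
    (hf : AEStronglyMeasurable f) {C : ℝ} (hC : ∀ z, ‖f z‖ ≤ C)
    (h : ∀ φ : 𝓢(Spacetime, ℂ), T φ = ∫ z, φ z * f z) : IsGivenBy T f := fun φ =>
  ⟨φ.integrable.mul_bdd hf (Filter.Eventually.of_forall hC), h φ⟩

/-- The change of variables y ↦ 2πy has Jacobian (2π)² on the plane; this is the constant of the
convolution theorem in angular frequencies. -/
theorem conv_comp_smul (f g : Spacetime → ℂ) (z : Spacetime) :
    conv (fun ω => f ((2 * Real.pi) • ω)) (fun ω => g ((2 * Real.pi) • ω)) z =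
      (((2 * Real.pi) ^ 2)⁻¹ : ℝ) * conv f g ((2 * Real.pi) • z) := by
  have := Measure.integral_comp_smul (volume : Measure Spacetime)
    (fun y => f y * g ((2 * Real.pi) • z - y)) (2 * Real.pi)
  simp only [conv, smul_sub]
  rw [this]
  simp [abs_of_pos Real.pi_pos]

/-- The product of two distributions with square integrable Fourier transforms. -/
theorem exists_isProduct {S T : 𝓢'(Spacetime, ℂ)} {f g : Spacetime → ℂ} (hS : HasFourier S f)
    (hT : HasFourier T g) (hf : MemLp f 2) (hg : MemLp g 2) :
    ∃ F : 𝓢'(Spacetime, ℂ), IsProduct S T F ∧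
      HasFourier F (fun z => (((2 * Real.pi) ^ 2)⁻¹ : ℝ) * conv f g z) ∧
      ∃ C : ℝ, ∀ z, ‖conv f g z‖ ≤ C := by
  have hf' := memLp_comp_smul hf two_pi_ne_zero
  have hg' := memLp_comp_smul hg two_pi_ne_zero
  set a : Lp (α := Spacetime) ℂ 2 := hf'.toLp _ with ha
  set b : Lp (α := Spacetime) ℂ 2 := hg'.toLp _ with hb
  have hconv : conv a b = fun z => (((2 * Real.pi) ^ 2)⁻¹ : ℝ) *
      conv f g ((2 * Real.pi) • z) := by
    rw [conv_congr_ae hf'.coeFn_toLp hg'.coeFn_toLp]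
    exact funext (conv_comp_smul f g)
  refine ⟨productDistribution (𝓕⁻ a) (𝓕⁻ b), ⟨_, _, Lp.memLp (𝓕⁻ a), Lp.memLp (𝓕⁻ b),
    hS.isGivenBy_fourierInv hf'.coeFn_toLp, hT.isGivenBy_fourierInv hg'.coeFn_toLp, fun φ =>
      ⟨?_, productDistribution_apply _ _ φ⟩⟩, ?_, ?_⟩
  · exact ((Lp.memLp (𝓕⁻ a)).integrable_mul (Lp.memLp (𝓕⁻ b))).bdd_mul
      φ.continuous.aestronglyMeasurable
      (Filter.Eventually.of_forall (SchwartzMap.norm_le_seminorm ℝ φ))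
  · have := isGivenBy_of_bound (T := 𝓕 (productDistribution (𝓕⁻ a) (𝓕⁻ b)))
      (aestronglyMeasurable_conv (Lp.aestronglyMeasurable a) (Lp.aestronglyMeasurable b))
      (norm_conv_le a b) (fourier_productDistribution a b)
    rw [hconv] at this
    exact this
  · refine ⟨‖(ContinuousLinearMap.mul ℂ ℂ).lpPairing (volume : Measure Spacetime) 2 2‖ *
      ‖hf.toLp f‖ * ‖hg.toLp g‖, fun z => ?_⟩
    rw [← conv_congr_ae hf.coeFn_toLp hg.coeFn_toLp]
    exact norm_conv_le _ _ z

theorem hasFourier_dx {T : 𝓢'(Spacetime, ℂ)} {g : Spacetime → ℂ} (h : HasFourier T g) :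
    HasFourier (dx T) (fun z => Complex.I * z 1 * g z) := by
  intro φ
  have hin (ω : Spacetime) : inner ℝ ω (EuclideanSpace.single (1 : Fin 2) (1 : ℝ)) = ω 1 := by
    simp [EuclideanSpace.inner_single_right]
  have htg : (fun ω : Spacetime =>
      ((inner ℝ ω (EuclideanSpace.single (1 : Fin 2) (1 : ℝ)) : ℝ) : ℂ)).HasTemperateGrowth := by
    fun_prop
  have h1 := h (SchwartzMap.smulLeftCLM ℂ (fun ω : Spacetime =>
    ((inner ℝ ω (EuclideanSpace.single (1 : Fin 2) (1 : ℝ)) : ℝ) : ℂ)) φ)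
  -- In Mathlib's normalization ∂_x has symbol 2πi ω₁, which is i z₁ at z = 2πω.
  have e : (fun ω => φ ω * (Complex.I * (((2 * Real.pi) • ω : Spacetime) 1 : ℝ) *
      g ((2 * Real.pi) • ω))) = fun ω => (2 * Real.pi * Complex.I) *
        ((SchwartzMap.smulLeftCLM ℂ (fun ω : Spacetime =>
        ((inner ℝ ω (EuclideanSpace.single (1 : Fin 2) (1 : ℝ)) : ℝ) : ℂ)) φ) ω *
        g ((2 * Real.pi) • ω)) := by
    ext ω
    rw [SchwartzMap.smulLeftCLM_apply_apply htg, hin]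
    simp
    ring
  rw [e]
  refine ⟨h1.1.const_mul _, ?_⟩
  rw [integral_const_mul, ← h1.2, dx, TemperedDistribution.fourier_lineDerivOp_eq]
  rfl

/-- A bounded measurable function is a Fourier transform. -/
theorem exists_hasFourier {g : Spacetime → ℂ} (hg : AEStronglyMeasurable g) {C : ℝ}
    (hC : ∀ z, ‖g z‖ ≤ C) : ∃ T : 𝓢'(Spacetime, ℂ), HasFourier T g := by
  have h1 : MemLp (fun ω => g ((2 * Real.pi) • ω)) ∞ :=
    memLp_comp_smul (memLp_top_of_bound hg C (Filter.Eventually.of_forall hC)) two_pi_ne_zero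
  refine ⟨𝓕⁻ (Lp.toTemperedDistribution (h1.toLp _)), ?_⟩
  rw [HasFourier, fourier_fourierInv_eq]
  exact (isGivenBy_toTemperedDistribution _).congr_ae h1.coeFn_toLp

/-! ### The estimate for the Fourier transforms -/

theorem weightedNorm_sq (δ s b : ℝ) (g : Spacetime → ℂ) :
    weightedNorm δ s b g ^ 2 =
      ∫⁻ z, (modWeight δ b z * (ENNReal.ofReal (bracket (z 1) ^ s) * ‖g z‖ₑ)) ^ 2 := by
  have h := eLpNorm_nnreal_pow_eq_lintegral (μ := (volume : Measure Spacetime)) (p := 2)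
    (f := fun z : Spacetime =>
      ((bracket (z 1) ^ s * bracket (z 0 - dispersion δ (z 1)) ^ b : ℝ) : ℂ) * g z) two_ne_zero
  have h2 : weightedNorm δ s b g ^ 2 = ∫⁻ z : Spacetime,
      ‖((bracket (z 1) ^ s * bracket (z 0 - dispersion δ (z 1)) ^ b : ℝ) : ℂ) * g z‖ₑ ^ 2 := by
    simpa [weightedNorm] using h
  rw [h2]
  refine lintegral_congr fun z => ?_
  have h1 := bracket_pos (z 1)
  have h2 := bracket_pos (z 0 - dispersion δ (z 1))
  rw [enorm_mul, ← ofReal_norm, Complex.norm_real, Real.norm_of_nonneg (by positivity),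
    ENNReal.ofReal_mul (by positivity), modWeight]
  ring

theorem weightedNorm_mono {δ s s' b : ℝ} (hs : s ≤ s') (g : Spacetime → ℂ) :
    weightedNorm δ s b g ≤ weightedNorm δ s' b g := by
  rw [← ENNReal.pow_le_pow_left_iff two_ne_zero, weightedNorm_sq, weightedNorm_sq]
  refine lintegral_mono fun z => ?_
  gcongr
  exact one_le_bracket _

theorem memLp_of_weightedNorm {δ s b : ℝ} (hs : 0 ≤ s) (hb : 0 ≤ b) {g : Spacetime → ℂ}
    (hg : AEStronglyMeasurable g) (h : weightedNorm δ s b g < ∞) : MemLp g 2 := by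
  refine ⟨hg, lt_of_le_of_lt (eLpNorm_mono fun z => ?_) h⟩
  have h1 : 1 ≤ bracket (z 1) ^ s := Real.one_le_rpow (one_le_bracket _) hs
  have h2 : 1 ≤ bracket (z 0 - dispersion δ (z 1)) ^ b := Real.one_le_rpow (one_le_bracket _) hb
  rw [norm_mul, Complex.norm_real, Real.norm_of_nonneg (by positivity)]
  exact le_mul_of_one_le_left (norm_nonneg _) (one_le_mul_of_one_le_of_one_le h1 h2)

theorem enorm_conv_weighted_le {s : ℝ} (hs : 0 ≤ s) {f g : Spacetime → ℂ} (hf : Measurable f)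
    (hg : Measurable g) (z : Spacetime) :
    ENNReal.ofReal (bracket (z 1) ^ s) * ‖conv f g z‖ₑ ≤ ENNReal.ofReal (2 ^ s) *
      ((∫⁻ ζ, (ENNReal.ofReal (bracket (ζ 1) ^ s) * ‖f ζ‖ₑ) * ‖g (z - ζ)‖ₑ) +
        ∫⁻ ζ, ‖f ζ‖ₑ * (ENNReal.ofReal (bracket ((z - ζ) 1) ^ s) * ‖g (z - ζ)‖ₑ)) := by
  calc _ ≤ ENNReal.ofReal (bracket (z 1) ^ s) * ∫⁻ ζ, ‖f ζ‖ₑ * ‖g (z - ζ)‖ₑ := by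
        gcongr
        refine (enorm_integral_le_lintegral_enorm _).trans_eq ?_
        simp only [enorm_mul]
    _ = ∫⁻ ζ, ENNReal.ofReal (bracket (z 1) ^ s) * (‖f ζ‖ₑ * ‖g (z - ζ)‖ₑ) := by
        rw [lintegral_const_mul' _ _ ENNReal.ofReal_ne_top]
    _ ≤ ∫⁻ ζ, ENNReal.ofReal (2 ^ s) *
        ((ENNReal.ofReal (bracket (ζ 1) ^ s) * ‖f ζ‖ₑ) * ‖g (z - ζ)‖ₑ +
        ‖f ζ‖ₑ * (ENNReal.ofReal (bracket ((z - ζ) 1) ^ s) * ‖g (z - ζ)‖ₑ)) := by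
        refine lintegral_mono fun ζ => ?_
        have h1 := bracket_pos (ζ 1)
        have h2 := bracket_pos ((z - ζ) 1)
        have h3 : ENNReal.ofReal (bracket (z 1) ^ s) ≤ ENNReal.ofReal (2 ^ s) *
            (ENNReal.ofReal (bracket (ζ 1) ^ s) + ENNReal.ofReal (bracket ((z - ζ) 1) ^ s)) := by
          rw [← ENNReal.ofReal_add (by positivity) (by positivity),
            ← ENNReal.ofReal_mul (by positivity)]
          apply ENNReal.ofReal_le_ofReal
          have := bracket_add_rpow_le hs (ζ 1) ((z - ζ) 1)
          rwa [show ζ 1 + (z - ζ) 1 = z 1 by simp] at this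
        calc _ ≤ ENNReal.ofReal (2 ^ s) * (ENNReal.ofReal (bracket (ζ 1) ^ s) +
              ENNReal.ofReal (bracket ((z - ζ) 1) ^ s)) * (‖f ζ‖ₑ * ‖g (z - ζ)‖ₑ) := by gcongr
          _ = _ := by ring
    _ = _ := by
        rw [lintegral_const_mul' _ _ ENNReal.ofReal_ne_top, lintegral_add_left (by fun_prop)]

/-- The bilinear estimate on the Fourier side. -/
theorem exists_weightedNorm_conv_le {s b c : ℝ} (hs : 0 ≤ s) (hb : 1 / 2 < b)
    (hc : c ≤ -(1 / 4)) :
    ∃ C : ℝ≥0, ∀ δ : ℝ, 0 ≤ δ → ∀ f g : Spacetime → ℂ, Measurable f → Measurable g →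
      (∀ z ∉ lowFreq δ, f z = 0) → (∀ z ∉ lowFreq δ, g z = 0) →
      weightedNorm δ s c ((lowFreq δ).indicator
        fun z => Complex.I * z 1 * ((((2 * Real.pi) ^ 2)⁻¹ : ℝ) * conv f g z)) ≤
      C * (weightedNorm δ s b f * weightedNorm δ 0 b g +
        weightedNorm δ 0 b f * weightedNorm δ s b g) := by
  set K : ℝ≥0∞ := 2 * ENNReal.ofReal (2 ^ b) ^ 2 * (ENNReal.ofReal (2 ^ (2 * b)) * 2 *
    decayIntegral (2 * b) * (ENNReal.ofReal (2 ^ (2 * b)) * 8 * decayIntegral (2 * b))) with hK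
  have hKtop : K ≠ ∞ := by
    have := (decayIntegral_lt_top (r := 2 * b) (by linarith)).ne
    finiteness
  set L : ℝ≥0∞ := ENNReal.ofReal (2 ^ s) ^ 2 * (2 * K) with hL
  have hLtop : L ≠ ∞ := by finiteness
  -- The estimate is proved for squares with constant L; L ≤ (1 + L)² avoids a square root.
  refine ⟨1 + L.toNNReal, fun δ hδ f g hf hg hf0 hg0 => ?_⟩
  have hC : L ≤ ((1 + L.toNNReal : ℝ≥0) : ℝ≥0∞) ^ 2 := by
    rw [ENNReal.coe_add, ENNReal.coe_one, ENNReal.coe_toNNReal hLtop]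
    calc L ≤ 1 + L := le_add_self
      _ ≤ (1 + L) ^ 2 := le_self_pow le_self_add two_ne_zero
  rw [← ENNReal.pow_le_pow_left_iff two_ne_zero, mul_pow (M := ℝ≥0∞)]
  refine le_trans ?_ (mul_le_mul_left hC _)
  set W : ℝ → Spacetime → ℝ≥0∞ := fun s z => ENNReal.ofReal (bracket (z 1) ^ s) with hW
  have hWm (s : ℝ) : Measurable (W s) := by rw [hW]; fun_prop
  set F : ℝ → Spacetime → ℝ≥0∞ := fun s z => W s z * ‖f z‖ₑ with hF
  set G : ℝ → Spacetime → ℝ≥0∞ := fun s z => W s z * ‖g z‖ₑ with hG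
  have hFm (s : ℝ) : Measurable (F s) := (hWm s).mul hf.enorm
  have hGm (s : ℝ) : Measurable (G s) := (hWm s).mul hg.enorm
  have hF0 (s : ℝ) : ∀ z ∉ lowFreq δ, F s z = 0 := fun z hz => by simp [hF, hf0 z hz]
  have hG0 (s : ℝ) : ∀ z ∉ lowFreq δ, G s z = 0 := fun z hz => by simp [hG, hg0 z hz]
  have hFz : F 0 = fun z => ‖f z‖ₑ := by ext z; simp [hF, hW]
  have hGz : G 0 = fun z => ‖g z‖ₑ := by ext z; simp [hG, hW]
  set X : ℝ → ℝ → Spacetime → ℝ≥0∞ := fun s t z =>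
    ENNReal.ofReal |z 1| * modWeight δ c z * ∫⁻ ζ, F s ζ * G t (z - ζ) with hX
  have hXm (s t : ℝ) : Measurable (X s t) := by
    have : Measurable fun z => ∫⁻ ζ, F s ζ * G t (z - ζ) := by
      apply Measurable.lintegral_prod_right
      fun_prop
    exact (by fun_prop : Measurable fun z : Spacetime =>
      ENNReal.ofReal |z 1| * modWeight δ c z).mul this
  have hXle (s t : ℝ) : ∫⁻ z in lowFreq δ, X s t z ^ 2 ≤
      K * (weightedNorm δ s b f * weightedNorm δ t b g) ^ 2 := by
    rw [mul_pow, weightedNorm_sq, weightedNorm_sq]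
    exact lintegral_conv_sq_le (by linarith) hc hδ (hFm s) (hGm t) (hF0 s) (hG0 t)
  have hpt (z : Spacetime) (hz : z ∈ lowFreq δ) :
      (modWeight δ c z * (W s z * ‖Complex.I * z 1 *
        ((((2 * Real.pi) ^ 2)⁻¹ : ℝ) * conv f g z)‖ₑ)) ^ 2 ≤
      ENNReal.ofReal (2 ^ s) ^ 2 * 2 * (X s 0 z ^ 2 + X 0 s z ^ 2) := by
    have h1 : ‖Complex.I * z 1 * ((((2 * Real.pi) ^ 2)⁻¹ : ℝ) * conv f g z)‖ₑ ≤
        ENNReal.ofReal |z 1| * ‖conv f g z‖ₑ := by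
      rw [← ofReal_norm, ← ofReal_norm, ← ENNReal.ofReal_mul (abs_nonneg _)]
      apply ENNReal.ofReal_le_ofReal
      rw [norm_mul, norm_mul, norm_mul, Complex.norm_I, one_mul, Complex.norm_real,
        Complex.norm_real, Real.norm_eq_abs]
      have h2 : ‖(((2 * Real.pi) ^ 2)⁻¹ : ℝ)‖ ≤ 1 := by
        rw [Real.norm_of_nonneg (by positivity)]
        apply inv_le_one_of_one_le₀
        have := Real.pi_gt_three
        nlinarith
      calc _ ≤ |z 1| * (1 * ‖conv f g z‖) := by gcongr
        _ = _ := by rw [one_mul]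
    have h2 := enorm_conv_weighted_le hs hf hg z
    have h3 : modWeight δ c z * (W s z * ‖Complex.I * z 1 *
        ((((2 * Real.pi) ^ 2)⁻¹ : ℝ) * conv f g z)‖ₑ) ≤
        ENNReal.ofReal (2 ^ s) * (X s 0 z + X 0 s z) := by
      calc _ ≤ modWeight δ c z * (W s z * (ENNReal.ofReal |z 1| * ‖conv f g z‖ₑ)) := by gcongr
        _ = ENNReal.ofReal |z 1| * modWeight δ c z * (W s z * ‖conv f g z‖ₑ) := by ring
        _ ≤ ENNReal.ofReal |z 1| * modWeight δ c z * _ := mul_le_mul_right h2 _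
        _ = _ := by
          simp only [hX, hFz, hGz]
          ring
    calc _ ≤ (ENNReal.ofReal (2 ^ s) * (X s 0 z + X 0 s z)) ^ 2 := by gcongr
      _ = ENNReal.ofReal (2 ^ s) ^ 2 * (X s 0 z + X 0 s z) ^ 2 := mul_pow _ _ _
      _ ≤ ENNReal.ofReal (2 ^ s) ^ 2 * (2 * (X s 0 z ^ 2 + X 0 s z ^ 2)) := by
        gcongr
        have := ENNReal.rpow_add_le_mul_rpow_add_rpow (X s 0 z) (X 0 s z) one_le_two
        norm_num at this
        exact_mod_cast this
      _ = _ := by ring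
  calc weightedNorm δ s c ((lowFreq δ).indicator
        fun z => Complex.I * z 1 * ((((2 * Real.pi) ^ 2)⁻¹ : ℝ) * conv f g z)) ^ 2
      = ∫⁻ z in lowFreq δ, (modWeight δ c z * (W s z * ‖Complex.I * z 1 *
        ((((2 * Real.pi) ^ 2)⁻¹ : ℝ) * conv f g z)‖ₑ)) ^ 2 := by
        rw [weightedNorm_sq, ← lintegral_indicator (measurableSet_lowFreq δ)]
        refine lintegral_congr fun z => ?_
        by_cases hz : z ∈ lowFreq δ
        · rw [Set.indicator_of_mem hz, Set.indicator_of_mem hz]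
        · rw [Set.indicator_of_notMem hz, Set.indicator_of_notMem hz]; simp
    _ ≤ ∫⁻ z in lowFreq δ, ENNReal.ofReal (2 ^ s) ^ 2 * 2 * (X s 0 z ^ 2 + X 0 s z ^ 2) :=
        setLIntegral_mono' (measurableSet_lowFreq δ) hpt
    _ = ENNReal.ofReal (2 ^ s) ^ 2 * 2 * ((∫⁻ z in lowFreq δ, X s 0 z ^ 2) +
        ∫⁻ z in lowFreq δ, X 0 s z ^ 2) := by
        rw [lintegral_const_mul' _ _ (by finiteness), lintegral_add_left (by fun_prop)]
    _ ≤ ENNReal.ofReal (2 ^ s) ^ 2 * 2 * (K * (weightedNorm δ s b f * weightedNorm δ 0 b g) ^ 2 +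
        K * (weightedNorm δ 0 b f * weightedNorm δ s b g) ^ 2) := by
        gcongr
        · exact hXle s 0
        · exact hXle 0 s
    _ = L * ((weightedNorm δ s b f * weightedNorm δ 0 b g) ^ 2 +
        (weightedNorm δ 0 b f * weightedNorm δ s b g) ^ 2) := by
        rw [hL]; ring
    _ ≤ _ := by
        gcongr
        rw [add_sq]
        have (x y w : ℝ≥0∞) : x + y ≤ x + w + y := by
          rw [add_right_comm]; exact le_self_add
        exact this _ _ _

/-! ### The main estimate -/

/-- Passes to a representative that is Borel measurable and vanishes at every point off the low
frequencies, as the pointwise kernel argument requires. -/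
theorem exists_measurable_hasFourier {δ : ℝ} {v u : 𝓢'(Spacetime, ℂ)} (h : IsLowProj δ v u) :
    ∃ g : Spacetime → ℂ, Measurable g ∧ (∀ z ∉ lowFreq δ, g z = 0) ∧ HasFourier u g := by
  obtain ⟨g, -, hg⟩ := h
  have hm := hg.aestronglyMeasurable
  refine ⟨(lowFreq δ).indicator (hm.mk _),
    hm.stronglyMeasurable_mk.measurable.indicator (measurableSet_lowFreq δ),
    fun z hz => Set.indicator_of_notMem hz _, hg.congr_ae ?_⟩
  filter_upwards [hm.ae_eq_mk] with z hz
  by_cases hzl : z ∈ lowFreq δ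
  · rw [hz, Set.indicator_of_mem hzl]
  · rw [Set.indicator_of_notMem hzl, Set.indicator_of_notMem hzl]

theorem exists_xNorm_dx_product_le {s b c : ℝ} (hs : 0 ≤ s) (hb : 1 / 2 < b)
    (hc : c ≤ -(1 / 4)) :
    ∃ C : ℝ≥0, ∀ δ : ℝ, 0 ≤ δ → ∀ v₁ v₂ u₁ u₂ : 𝓢'(Spacetime, ℂ),
      IsLowProj δ v₁ u₁ → IsLowProj δ v₂ u₂ → XNorm δ s b u₁ < ∞ → XNorm δ s b u₂ < ∞ →
      ∃ F W : 𝓢'(Spacetime, ℂ), IsProduct u₁ u₂ F ∧ IsLowProj δ (dx F) W ∧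
        XNorm δ s c W ≤ C * (XNorm δ s b u₁ * XNorm δ 0 b u₂ + XNorm δ 0 b u₁ * XNorm δ s b u₂) := by
  obtain ⟨C, hC⟩ := exists_weightedNorm_conv_le hs hb hc
  refine ⟨C, fun δ hδ v₁ v₂ u₁ u₂ h₁ h₂ hu₁ hu₂ => ?_⟩
  obtain ⟨f, hfm, hf0, hf⟩ := exists_measurable_hasFourier h₁
  obtain ⟨g, hgm, hg0, hg⟩ := exists_measurable_hasFourier h₂
  simp only [hf.xNorm_eq, hg.xNorm_eq] at hu₁ hu₂ ⊢
  have hf2 := memLp_of_weightedNorm hs (by linarith) hfm.aestronglyMeasurable hu₁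
  have hg2 := memLp_of_weightedNorm hs (by linarith) hgm.aestronglyMeasurable hu₂
  obtain ⟨F, hF, hFF, B, hB⟩ := exists_isProduct hf hg hf2 hg2
  have hdF := hasFourier_dx hFF
  have hm : AEStronglyMeasurable ((lowFreq δ).indicator
      fun z => (((2 * Real.pi) ^ 2)⁻¹ : ℝ) * conv f g z) :=
    ((aestronglyMeasurable_conv hfm.aestronglyMeasurable hgm.aestronglyMeasurable).const_mul
      _).indicator (measurableSet_lowFreq δ)
  -- The truncated convolution is bounded, hence a Fourier transform. The projection commutes with
  -- ∂_x, so W can be taken as `dx S`, whose symbol carries the factor ξ even when that is unbounded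
  -- (δ = 0).
  obtain ⟨S, hS⟩ := exists_hasFourier (C := ‖((((2 * Real.pi) ^ 2)⁻¹ : ℝ) : ℂ)‖ * B) hm
    (fun z => by
      refine (norm_indicator_le_norm_self _ _).trans ?_
      rw [norm_mul]
      gcongr
      exact hB z)
  have hW : HasFourier (dx S) ((lowFreq δ).indicator
      fun z => Complex.I * z 1 * ((((2 * Real.pi) ^ 2)⁻¹ : ℝ) * conv f g z)) := by
    convert hasFourier_dx hS using 1
    ext z
    by_cases hz : z ∈ lowFreq δ
    · rw [Set.indicator_of_mem hz, Set.indicator_of_mem hz]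
    · rw [Set.indicator_of_notMem hz, Set.indicator_of_notMem hz, mul_zero]
  refine ⟨F, dx S, hF, ⟨_, hdF, hW⟩, ?_⟩
  rw [hW.xNorm_eq]
  exact hC δ hδ f g hfm hgm hf0 hg0

theorem xNorm_mono_of_isLowProj {δ s s' b : ℝ} (hs : s ≤ s') {v u : 𝓢'(Spacetime, ℂ)}
    (h : IsLowProj δ v u) : XNorm δ s b u ≤ XNorm δ s' b u := by
  obtain ⟨g, -, -, hg⟩ := exists_measurable_hasFourier h
  rw [hg.xNorm_eq, hg.xNorm_eq]
  exact weightedNorm_mono hs g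

end ScaledILW

theorem mainTheorem3 (s b b' : ℝ) (hs : 0 ≤ s) (hb : 1 / 2 < b) (hb' : b' ≤ 5 / 8) :
    ∃ C : ℝ≥0, ∀ δ : ℝ, 0 ≤ δ → δ ≤ 1 →
      (∀ v₁ v₂ u₁ u₂ : 𝓢'(ScaledILW.Spacetime, ℂ),
        ScaledILW.IsLowProj δ v₁ u₁ → ScaledILW.IsLowProj δ v₂ u₂ →
        ScaledILW.XNorm δ s b u₁ < ∞ → ScaledILW.XNorm δ s b u₂ < ∞ →
        ∃ F W : 𝓢'(ScaledILW.Spacetime, ℂ),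
          ScaledILW.IsProduct u₁ u₂ F ∧ ScaledILW.IsLowProj δ (ScaledILW.dx F) W ∧
          ScaledILW.XNorm δ s (b' - 1) W
            ≤ C * (ScaledILW.XNorm δ s b u₁ * ScaledILW.XNorm δ s b u₂)) ∧
      (∀ v u : 𝓢'(ScaledILW.Spacetime, ℂ),
        ScaledILW.IsLowProj δ v u → ScaledILW.XNorm δ s b u < ∞ →
        ∃ F W : 𝓢'(ScaledILW.Spacetime, ℂ),
          ScaledILW.IsProduct u u F ∧ ScaledILW.IsLowProj δ (ScaledILW.dx F) W ∧
          ScaledILW.XNorm δ s (b' - 1) W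
            ≤ C * (ScaledILW.XNorm δ 0 b u * ScaledILW.XNorm δ s b u)) := by
  obtain ⟨C, hC⟩ := ScaledILW.exists_xNorm_dx_product_le (c := b' - 1) hs hb (by linarith)
  -- The 2 counts the two Leibniz terms: in the first estimate each X^{0,b} norm is at most the
  -- X^{s,b} norm, in the second the two terms coincide.
  refine ⟨C * 2, fun δ hδ _ => ⟨fun v₁ v₂ u₁ u₂ h₁ h₂ hu₁ hu₂ => ?_, fun v u h hu => ?_⟩⟩
  · obtain ⟨F, W, hF, hW, hle⟩ := hC δ hδ v₁ v₂ u₁ u₂ h₁ h₂ hu₁ hu₂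
    refine ⟨F, W, hF, hW, hle.trans ?_⟩
    have m₁ := ScaledILW.xNorm_mono_of_isLowProj (b := b) hs h₁
    have m₂ := ScaledILW.xNorm_mono_of_isLowProj (b := b) hs h₂
    rw [ENNReal.coe_mul, mul_assoc, ENNReal.coe_ofNat, two_mul]
    gcongr
  · obtain ⟨F, W, hF, hW, hle⟩ := hC δ hδ v v u u h h hu hu
    refine ⟨F, W, hF, hW, hle.trans_eq ?_⟩
    rw [ENNReal.coe_mul, mul_assoc, ENNReal.coe_ofNat, two_mul, mul_comm (ScaledILW.XNorm δ s b u)]
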